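/- For $f_i:\mathbb{R}^{n_i}\to(-\infty,+\infty]$, matrices $A_i$ and a vector $b\in\mathbb{R}^m$ $(i=1,\dots,N)$, consider the separable problem of minimising $\sum_i f_i(x^i)$ subject to $\sum_i A_ix^i\le b$, with optimal value $p$, and its dual of maximising $-\sum_i f_i^*(-A_i^Ty)-b^Ty$ subject to $y\ge 0$, with optimal value $d$, where $f_i^*$ is the conjugate of $f_i$. The duality gap is $p-d$. Let $N,L\ge 1$ be integers. **Single-path routing.** Consider a network with $N$ users and $L$ links with capacities $c\in\mathbb{R}^L$, $c>0$; put $\|c\|_\infty=\max_l c_l$. User $i$ has $K^i\ge 1$ paths, and its routing matrix $R^i\in\{0,1\}^{L\times K^i}$ has $R^i_{lk}=1$ iff the $k$th path of user $i$ passes through link $l$. Take $A_i=R^i$ and $b=c$. (a) (Throughput utility.) If $f_i(x)=-\max_s x_s$ for $0\le x\le\|c\|_\infty$ and $f_i(x)=+\infty$ otherwise, then $p$ and $d$ are finite and $$p-d\le \min\{N,L\}\,\frac{L}{L+\min\{N,L\}}\,\|c\|_\infty .$$ (b) (Logarithmic utility.) If $f_i(x)=-\log\max_s x_s$ for $0\le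 x\le\|c\|_\infty$, $x\ne 0$, and $f_i(x)=+\infty$ otherwise, then $p$ and $d$ are finite and $$p-d\le \min\{N,L\}\,\log\Bigl(1+\frac{L}{\min\{N,L\}}\Bigr).$$ If moreover every path passes through at least one link, then in both cases $-p$ is the optimal value of the network utility maximisation problem: maximise $\sum_i U(x^i)$ subject to $\sum_iR^ix^i\le c$ and $x^i\ge0$ for all $i$, where $U(x)=\max_s x_s$, respectively $U(x)=\log\max_s x_s$ (with $\log 0=-\infty$). **Dynamic spectrum management.** Let $L$ users share $N$ tones with noises $0<\sigma_i\le 1$ $(i=1,\dots,N)$, $\sigma=\min_i\sigma_i$, and let the power budgets be $0\le p_l\le 1$ $(l=1,\dots,L)$. For a power vector $x^i\in\mathbb{R}^L$ on tone $i$, the rate of user $l$ is $u^i_l(x^i)=\frac1N\log\bigl(1+\frac{x^i_l}{\|x^i\|_1-x^i_l+\sigma_i}\bigr)$. Take $f_i(x)=-\sum_{l=1}^L u^i_l(x)$ for $0\le x\le 1$ and $f_i(x)=+\infty$ otherwise, with constraint $\sum_i x^i_l\le p_l$ for all $l$ (that is, $A_i=I$ and $b=(p_l)_l$). (c) Then $p$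 and $d$ are finite, $-p$ is the maximum total throughput, i.e. the supremum of $\sum_{l}\sum_{i}u^i_l(x^i)$ over all $x^i\ge 0$ with $\sum_i x^i_l\le p_l$ for all $l$, and $$p-d\le \frac{\min\{N,L\}}{N}\,\log\frac{1+L/\min\{N,L\}}{\sigma}.$$ -/

import Mathlib

open scoped Matrix

noncomputable section

/-- The optimal value of the separable problem
minimise `∑ i, f i (x i)` subject to `∑ i, A i *ᵥ x i ≤ b` (componentwise). -/
def primalValue {n m : ℕ} {K : Fin n → ℕ} (f : ∀ i, (Fin (K i) → ℝ) → EReal)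
    (A : ∀ i, Matrix (Fin m) (Fin (K i)) ℝ) (b : Fin m → ℝ) : EReal :=
  ⨅ (x : ∀ i, Fin (K i) → ℝ) (_ : ∑ i, A i *ᵥ x i ≤ b), ∑ i, f i (x i)

/-- The conjugate function `f^*(y) = sup_x (⟨y, x⟩ - f x)`. -/
def conjugateFun {k : ℕ} (f : (Fin k → ℝ) → EReal) (y : Fin k → ℝ) : EReal :=
  ⨆ x : Fin k → ℝ, ((y ⬝ᵥ x : ℝ) : EReal) - f x

/-- The optimal value of the dual problem
maximise `-∑ i, (f i)^* (-(A i)ᵀ y) - bᵀ y` subject to `y ≥ 0`. -/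
def dualValue {n m : ℕ} {K : Fin n → ℕ} (f : ∀ i, (Fin (K i) → ℝ) → EReal)
    (A : ∀ i, Matrix (Fin m) (Fin (K i)) ℝ) (b : Fin m → ℝ) : EReal :=
  ⨆ (y : Fin m → ℝ) (_ : 0 ≤ y),
    -(∑ i, conjugateFun (f i) (-((A i)ᵀ *ᵥ y))) - ((b ⬝ᵥ y : ℝ) : EReal)

/-- The optimal value of the utility maximisation problem
maximise `∑ i, U i (x i)` subject to `∑ i, A i *ᵥ x i ≤ b` and `x i ≥ 0` for all `i`. -/
def utilityValue {n m : ℕ} {K : Fin n → ℕ} (U : ∀ i, (Fin (K i) → ℝ) → EReal)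
    (A : ∀ i, Matrix (Fin m) (Fin (K i)) ℝ) (b : Fin m → ℝ) : EReal :=
  ⨆ (x : ∀ i, Fin (K i) → ℝ) (_ : (∀ i, 0 ≤ x i) ∧ ∑ i, A i *ᵥ x i ≤ b), ∑ i, U i (x i)

/-- The extended-valued objective that equals `-U` on the box `0 ≤ x ≤ M`
and `+∞` outside of it. -/
def boxObjective {k : ℕ} (M : ℝ) (U : (Fin k → ℝ) → EReal) (x : Fin k → ℝ) : EReal :=
  if ∀ s, 0 ≤ x s ∧ x s ≤ M then -U x else ⊤

/-- The routing matrix of a user with `k` paths, each given by the set of links it passes. -/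
def routingMatrix {L k : ℕ} (path : Fin k → Finset (Fin L)) : Matrix (Fin L) (Fin k) ℝ :=
  Matrix.of fun l s => if l ∈ path s then 1 else 0

/-- Single-path throughput utility `max_s x_s`. -/
def throughputUtility {k : ℕ} (x : Fin k → ℝ) : EReal :=
  ((⨆ s, x s : ℝ) : EReal)

/-- Single-path logarithmic utility `log (max_s x_s)`, equal to `-∞` if the maximum
is not positive. -/
def logUtility {k : ℕ} (x : Fin k → ℝ) : EReal :=
  if 0 < ⨆ s, x s then ((Real.log (⨆ s, x s) : ℝ) : EReal) else ⊥

/-- The rate of user `l` on a tone with noise `σ` and power vector `x`, when the band is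
divided into `N` tones. -/
def toneRate (N : ℕ) {L : ℕ} (σ : ℝ) (x : Fin L → ℝ) (l : Fin L) : ℝ :=
  1 / (N : ℝ) * Real.log (1 + x l / ((∑ j, |x j|) - x l + σ))

/-- The total rate of all users on one tone. -/
def toneThroughput (N : ℕ) {L : ℕ} (σ : ℝ) (x : Fin L → ℝ) : EReal :=
  ((∑ l, toneRate N σ x l : ℝ) : EReal)

end

/-!
Lagrangian duality replaces each objective by its convex envelope, so the dual value `d` is the
value of the problem in which every block `xⁱ` is a convex combination of points at which the
objective is averaged. By the Shapley–Folkman lemma, in the form of Carathéodory's theorem for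
cones, an optimal choice of the `n` combinations uses at most `n + m` points in total, where `m` is
the number of constraints. Replacing the `i`th combination, of `kᵢ` points, by its barycentre costs
at most `g kᵢ`, where `g` bounds the nonconvexity measures of the objectives, and nothing if
`kᵢ = 1`, so at most `min n m` blocks contribute. Concavity of `g` then bounds the total cost by
`min n m * g (1 + m / min n m)`.

The three nonconvexity bounds are `(1 - 1 / k) * M` for the negative of the maximum on a box of side
`M`, `log k` for the negative of its logarithm, and `log (k / σ) / N` for a tone with noise `σ`.
-/

section Caratheodory

variable {𝕜 J V : Type*} [Field 𝕜] [LinearOrder 𝕜] [IsStrictOrderedRing 𝕜] [AddCommGroup V]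
  [Module 𝕜 V]

theorem exists_add_smul_nonneg_support_ssubset {α β : J →₀ 𝕜} (hα : 0 ≤ α)
    (hβα : β.support ⊆ α.support) (hβ : ∃ j, β j < 0) :
    ∃ t : 𝕜, 0 ≤ t ∧ 0 ≤ α + t • β ∧ (α + t • β).support ⊂ α.support := by
  have mem_support {j} (hj : β j < 0) : j ∈ α.support := hβα (Finsupp.mem_support_iff.2 hj.ne)
  obtain ⟨j₁, hj₁⟩ := hβ
  -- the largest admissible step is where the first coordinate vanishes
  obtain ⟨j₀, hj₀, hmin⟩ := (α.support.filter (β · < 0)).exists_min_image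
    (fun j ↦ α j / -β j) ⟨j₁, Finset.mem_filter.2 ⟨mem_support hj₁, hj₁⟩⟩
  obtain ⟨hj₀α, hj₀β⟩ := Finset.mem_filter.1 hj₀
  have ht : 0 ≤ α j₀ / -β j₀ := div_nonneg (hα j₀) (neg_nonneg.2 hj₀β.le)
  have vanishes : (α + (α j₀ / -β j₀) • β) j₀ = 0 := by
    have := hj₀β.ne
    simp only [Finsupp.add_apply, Finsupp.smul_apply, smul_eq_mul]
    field_simp
    ring
  refine ⟨α j₀ / -β j₀, ht, fun j ↦ ?_, fun j hj ↦ ?_, fun h ↦ ?_⟩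
  · change 0 ≤ α j + α j₀ / -β j₀ * β j
    rcases lt_or_ge (β j) 0 with hj | hj
    · have hle := hmin j (Finset.mem_filter.2 ⟨mem_support hj, hj⟩)
      rw [le_div_iff₀ (neg_pos.2 hj)] at hle
      linarith
    · exact add_nonneg (hα j) (mul_nonneg ht hj)
  · by_contra hjα
    have hjβ : β j = 0 := Finsupp.notMem_support_iff.1 fun h ↦ hjα (hβα h)
    simp [Finsupp.notMem_support_iff.1 hjα, hjβ] at hj
  · exact Finsupp.mem_support_iff.1 (h hj₀α) vanishes

theorem exists_linearCombination_eq_zero_of_finrank_lt [FiniteDimensional 𝕜 V] (v : J → V)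
    (c : J → 𝕜) {s : Finset J} (hs : Module.finrank 𝕜 V < s.card) :
    ∃ β : J →₀ 𝕜, β.support ⊆ s ∧ β ≠ 0 ∧ Finsupp.linearCombination 𝕜 v β = 0 ∧
      Finsupp.linearCombination 𝕜 c β ≤ 0 := by
  have dependent : ¬ LinearIndepOn 𝕜 v (s : Set J) := fun h ↦ hs.not_ge <| by
    simpa using LinearIndependent.fintype_card_le_finrank h
  rw [linearIndepOn_iff] at dependent
  push Not at dependent
  obtain ⟨β, hβs, hvβ, hβ⟩ := dependent
  rw [Finsupp.mem_supported, Finset.coe_subset] at hβs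
  rcases le_total (Finsupp.linearCombination 𝕜 c β) 0 with hc | hc
  · exact ⟨β, hβs, hβ, hvβ, hc⟩
  · exact ⟨-β, by rwa [Finsupp.support_neg], neg_ne_zero.2 hβ, by simp [hvβ], by simpa using hc⟩

/-- Carathéodory's theorem for cones, with a linear cost. The hypothesis on `v` makes the cost
bounded below. -/
theorem exists_support_card_le_finrank [FiniteDimensional 𝕜 V] (v : J → V) (c : J → 𝕜)
    (hv : ∀ β : J →₀ 𝕜, 0 ≤ β → Finsupp.linearCombination 𝕜 v β = 0 → β = 0)
    (α : J →₀ 𝕜) (hα : 0 ≤ α) :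
    ∃ α' : J →₀ 𝕜, 0 ≤ α' ∧ α'.support ⊆ α.support ∧
      Finsupp.linearCombination 𝕜 v α' = Finsupp.linearCombination 𝕜 v α ∧
      Finsupp.linearCombination 𝕜 c α' ≤ Finsupp.linearCombination 𝕜 c α ∧
      α'.support.card ≤ Module.finrank 𝕜 V := by
  induction hs : α.support using Finset.strongInduction generalizing α with
  | _ s ih =>
    subst hs
    rcases le_or_gt α.support.card (Module.finrank 𝕜 V) with hcard | hcard
    · exact ⟨α, hα, subset_rfl, rfl, le_rfl, hcard⟩
    obtain ⟨β, hβα, hβ, hvβ, hcβ⟩ := exists_linearCombination_eq_zero_of_finrank_lt v c hcard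
    have hneg : ∃ j, β j < 0 := by
      by_contra! h
      exact hβ (hv β h hvβ)
    obtain ⟨t, ht, hnonneg, hssub⟩ := exists_add_smul_nonneg_support_ssubset hα hβα hneg
    obtain ⟨α', hα', hsub, hvα', hcα', hcard'⟩ := ih _ hssub (α + t • β) hnonneg rfl
    refine ⟨α', hα', hsub.trans hssub.subset, by simpa [hvβ] using hvα', hcα'.trans ?_, hcard'⟩
    simpa using mul_nonpos_of_nonneg_of_nonpos ht hcβ

end Caratheodory

section ConvexWeights

variable (𝕜 : Type*) [Field 𝕜] [LinearOrder 𝕜]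

/-- The finitely supported probability weights on the set `D`. -/
def convexWeights {E : Type*} (D : Set E) : Set (E →₀ 𝕜) :=
  {w | 0 ≤ w ∧ ↑w.support ⊆ D ∧ Finsupp.linearCombination 𝕜 (fun _ ↦ (1 : 𝕜)) w = 1}

variable {𝕜}

section

variable {E : Type*} {D : Set E} {w : E →₀ 𝕜}

theorem sum_eq_one_of_mem_convexWeights (hw : w ∈ convexWeights 𝕜 D) :
    ∑ x ∈ w.support, w x = 1 := by
  simpa [Finsupp.linearCombination_apply, Finsupp.sum] using hw.2.2

variable [IsStrictOrderedRing 𝕜]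

theorem support_nonempty_of_mem_convexWeights (hw : w ∈ convexWeights 𝕜 D) :
    w.support.Nonempty :=
  Finset.nonempty_of_sum_ne_zero (f := w)
    (by rw [sum_eq_one_of_mem_convexWeights hw]; exact one_ne_zero)

theorem single_mem_convexWeights {x : E} (hx : x ∈ D) :
    Finsupp.single x 1 ∈ convexWeights 𝕜 D := by
  refine ⟨Finsupp.single_nonneg.2 zero_le_one, ?_, by simp⟩
  simpa using hx

theorem convex_convexWeights (D : Set E) : Convex 𝕜 (convexWeights 𝕜 D) := by
  classical
  rintro w ⟨hw, hwD, hw1⟩ u ⟨hu, huD, hu1⟩ a b ha hb hab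
  refine ⟨add_nonneg (smul_nonneg ha hw) (smul_nonneg hb hu), fun x hx ↦ ?_, by simp [*]⟩
  rcases Finset.mem_union.1 (Finsupp.support_add hx) with h | h
  · exact hwD (Finsupp.support_smul h)
  · exact huD (Finsupp.support_smul h)

theorem barycenter_mem_of_mem_convexWeights [AddCommGroup E] [Module 𝕜 E] (hD : Convex 𝕜 D)
    (hw : w ∈ convexWeights 𝕜 D) : Finsupp.linearCombination 𝕜 id w ∈ D :=
  hD.sum_mem (fun x _ ↦ hw.1 x) (sum_eq_one_of_mem_convexWeights hw) fun _ hx ↦ hw.2.1 hx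

theorem linearCombination_le_of_concaveOn [AddCommGroup E] [Module 𝕜 E] {F h : E → 𝕜}
    (hh : ConcaveOn 𝕜 D h) (hF : ∀ x ∈ D, F x ≤ h x) (hw : w ∈ convexWeights 𝕜 D) :
    Finsupp.linearCombination 𝕜 F w ≤ h (Finsupp.linearCombination 𝕜 id w) :=
  calc ∑ x ∈ w.support, w x * F x
      ≤ ∑ x ∈ w.support, w x * h x := Finset.sum_le_sum fun x hx ↦
        mul_le_mul_of_nonneg_left (hF x (hw.2.1 hx)) (hw.1 x)
    _ ≤ h (∑ x ∈ w.support, w x • x) :=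
        hh.le_map_sum (fun x _ ↦ hw.1 x) (sum_eq_one_of_mem_convexWeights hw)
          fun _ hx ↦ hw.2.1 hx

theorem linearCombination_le_of_mem_convexWeights {F : E → 𝕜} {M : 𝕜} (hF : ∀ x ∈ D, F x ≤ M)
    (hw : w ∈ convexWeights 𝕜 D) : Finsupp.linearCombination 𝕜 F w ≤ M :=
  calc ∑ x ∈ w.support, w x * F x
      ≤ ∑ x ∈ w.support, w x * M := Finset.sum_le_sum fun x hx ↦
        mul_le_mul_of_nonneg_left (hF x (hw.2.1 hx)) (hw.1 x)
    _ = M := by rw [← Finset.sum_mul, sum_eq_one_of_mem_convexWeights hw, one_mul]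

end

section Blocks

variable {ι : Type*} {E : ι → Type*}

theorem fst_linearCombination {R E V W : Type*} [Semiring R] [AddCommMonoid V]
    [Module R V] [AddCommMonoid W] [Module R W] (f : E → V × W) (w : E →₀ R) :
    (Finsupp.linearCombination R f w).1 = Finsupp.linearCombination R (fun x ↦ (f x).1) w :=
  Finsupp.apply_linearCombination R (LinearMap.fst R V W) f w

theorem snd_linearCombination {R E V W : Type*} [Semiring R] [AddCommMonoid V]
    [Module R V] [AddCommMonoid W] [Module R W] (f : E → V × W) (w : E →₀ R) :
    (Finsupp.linearCombination R f w).2 = Finsupp.linearCombination R (fun x ↦ (f x).2) w :=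
  Finsupp.apply_linearCombination R (LinearMap.snd R V W) f w

theorem linearCombination_sigma {R V : Type*} [Semiring R] [AddCommMonoid V] [Module R V]
    [Fintype ι] (g : (Σ i, E i) → V) (α : (Σ i, E i) →₀ R) :
    Finsupp.linearCombination R g α =
      ∑ i, Finsupp.linearCombination R (fun x ↦ g ⟨i, x⟩) (α.split i) := by
  simp only [Finsupp.linearCombination_apply]
  rw [Finsupp.sigma_sum]
  refine Finset.sum_subset (Finset.subset_univ _) fun i _ hi ↦ ?_
  rw [Finsupp.mem_splitSupport_iff_nonzero, not_not] at hi
  simp [hi]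

theorem card_support_sigma {R : Type*} [Zero R] [Fintype ι] (α : (Σ i, E i) →₀ R) :
    α.support.card = ∑ i, (α.split i).support.card := by
  rw [Finsupp.sigma_support, Finset.card_sigma]
  refine Finset.sum_subset (Finset.subset_univ _) fun i _ hi ↦ ?_
  rw [Finsupp.mem_splitSupport_iff_nonzero, not_not] at hi
  simp [hi]

theorem linearCombination_pi_single_apply {R : Type*} [Semiring R] [Finite ι]
    [DecidableEq ι] (α : (Σ i, E i) →₀ R) (i : ι) :
    Finsupp.linearCombination R (fun j : Σ i, E i ↦ (Pi.single j.1 1 : ι → R)) α i =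
      Finsupp.linearCombination R (fun _ ↦ (1 : R)) (α.split i) := by
  cases nonempty_fintype ι
  rw [linearCombination_sigma, Finset.sum_apply, Finset.sum_eq_single i]
  · simp [Finsupp.linearCombination_apply, Finsupp.sum, Finset.sum_apply]
  · intro i' _ hi'
    simp [Finsupp.linearCombination_apply, Finsupp.sum, Finset.sum_apply, hi'.symm]
  · simp

variable [IsStrictOrderedRing 𝕜] [Fintype ι] {V : Type*} [AddCommGroup V] [Module 𝕜 V]

theorem convex_image_sum_linearCombination {D : ∀ i, Set (E i)}
    (G : ∀ i, E i → V) :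
    Convex 𝕜 ((fun w : ∀ i, E i →₀ 𝕜 ↦ ∑ i, Finsupp.linearCombination 𝕜 (G i) (w i)) ''
      Set.univ.pi fun i ↦ convexWeights 𝕜 (D i)) := by
  have h := (convex_pi fun i (_ : i ∈ Set.univ) ↦ convex_convexWeights (𝕜 := 𝕜) (D i)).linear_image
    (∑ i, Finsupp.linearCombination 𝕜 (G i) ∘ₗ LinearMap.proj i)
  simpa [LinearMap.sum_apply] using h

/-- The Shapley–Folkman lemma, with a separable cost. -/
theorem exists_convexWeights_sum_card_le [FiniteDimensional 𝕜 V] {D : ∀ i, Set (E i)}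
    (v : ∀ i, E i → V) (c : ∀ i, E i → 𝕜) {w : ∀ i, E i →₀ 𝕜}
    (hw : ∀ i, w i ∈ convexWeights 𝕜 (D i)) :
    ∃ w' : ∀ i, E i →₀ 𝕜, (∀ i, w' i ∈ convexWeights 𝕜 (D i)) ∧
      ∑ i, Finsupp.linearCombination 𝕜 (v i) (w' i) =
        ∑ i, Finsupp.linearCombination 𝕜 (v i) (w i) ∧
      ∑ i, Finsupp.linearCombination 𝕜 (c i) (w' i) ≤
        ∑ i, Finsupp.linearCombination 𝕜 (c i) (w i) ∧
      ∑ i, (w' i).support.card ≤ Module.finrank 𝕜 V + Fintype.card ι := by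
  classical
  obtain ⟨α, rfl⟩ : ∃ α : (Σ i, E i) →₀ 𝕜, α.split = w :=
    ⟨Finsupp.sigmaFinsuppEquivPiFinsupp.symm w,
      Finsupp.sigmaFinsuppEquivPiFinsupp.apply_symm_apply w⟩
  -- the second component keeps the total weight of every block
  let g : (Σ i, E i) → V × (ι → 𝕜) := fun j ↦ (v j.1 j.2, Pi.single j.1 1)
  have fst_g (β) : (Finsupp.linearCombination 𝕜 g β).1 =
      ∑ i, Finsupp.linearCombination 𝕜 (v i) (β.split i) :=
    (fst_linearCombination g β).trans (linearCombination_sigma _ β)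
  have snd_g (β) (i) : (Finsupp.linearCombination 𝕜 g β).2 i =
      Finsupp.linearCombination 𝕜 (fun _ ↦ (1 : 𝕜)) (β.split i) :=
    (congrFun (snd_linearCombination g β) i).trans (linearCombination_pi_single_apply β i)
  have pointed (β : (Σ i, E i) →₀ 𝕜) (hβ : 0 ≤ β)
      (h : Finsupp.linearCombination 𝕜 g β = 0) : β = 0 := by
    ext ⟨i, x⟩
    have hi := snd_g β i
    rw [h, Finsupp.linearCombination_apply, Finsupp.sum] at hi
    by_contra hne
    refine hne ?_
    have hi' := (Finset.sum_eq_zero_iff_of_nonneg fun y _ ↦ ?_).1 hi.symm x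
    · simpa [Finsupp.split_apply, imp_iff_right hne] using hi'
    · simpa [Finsupp.split_apply] using hβ ⟨i, y⟩
  obtain ⟨α', hα', hsub, hg, hc, hcard⟩ := exists_support_card_le_finrank g (fun j ↦ c j.1 j.2)
    pointed α fun j ↦ (hw j.1).1 j.2
  rw [linearCombination_sigma, linearCombination_sigma] at hc
  refine ⟨α'.split, fun i ↦ ⟨fun x ↦ hα' ⟨i, x⟩, fun x hx ↦ (hw i).2.1 ?_, ?_⟩, ?_, hc, ?_⟩
  · simpa [Finsupp.split_apply] using @hsub ⟨i, x⟩ (by simpa [Finsupp.split_apply] using hx)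
  · rw [← snd_g, hg, snd_g, (hw i).2.2]
  · rw [← fst_g, hg, fst_g]
  · simpa [card_support_sigma] using hcard

end Blocks

end ConvexWeights

section Multipliers

theorem nonneg_of_forall_map_Iic_le {E : Type*} [AddCommGroup E] [PartialOrder E]
    [IsOrderedAddMonoid E] [Module ℝ E] [PosSMulMono ℝ E] {φ : E →ₗ[ℝ] ℝ} {a : E} {u : ℝ}
    (h : ∀ x ≤ a, φ x ≤ u) {v : E} (hv : 0 ≤ v) : 0 ≤ φ v := by
  by_contra! hneg
  obtain ⟨k, hk⟩ := exists_nat_gt ((u - φ a) / -φ v)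
  rw [div_lt_iff₀ (neg_pos.2 hneg)] at hk
  have hle := h (a - (k : ℝ) • v) (sub_le_self a (smul_nonneg k.cast_nonneg hv))
  rw [map_sub, map_smul, smul_eq_mul] at hle
  linarith

variable {κ : Type*}

theorem exists_lt_forall_le_of_convex [Finite κ] {C : Set ((κ → ℝ) × ℝ)} (hC : Convex ℝ C)
    {b : κ → ℝ} {r : ℝ} (hr : ∀ a ∈ C, a.1 ≤ b → r ≤ a.2) :
    ∃ (φ : (κ → ℝ) × ℝ →L[ℝ] ℝ) (u : ℝ), (∀ a, (∀ l, a.1 l < b l) → a.2 < r → φ a < u) ∧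
      (∀ a ≤ (b, r), φ a ≤ u) ∧ ∀ a ∈ C, u ≤ φ a := by
  let Q : Set ((κ → ℝ) × ℝ) := (Set.univ.pi fun l ↦ Set.Iio (b l)) ×ˢ Set.Iio r
  have Q_convex : Convex ℝ Q := (convex_pi fun l _ ↦ convex_Iio (b l)).prod (convex_Iio r)
  have Q_open : IsOpen Q :=
    (isOpen_set_pi Set.finite_univ fun l _ ↦ isOpen_Iio).prod isOpen_Iio
  have disjoint : Disjoint Q C := Set.disjoint_left.2 fun a ⟨ha, har⟩ haC ↦
    (hr a haC fun l ↦ (ha l trivial).le).not_gt har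
  obtain ⟨φ, u, hQ, hu⟩ := geometric_hahn_banach_open Q_convex Q_open hC disjoint
  refine ⟨φ, u, fun a ha har ↦ hQ a ⟨fun l _ ↦ ha l, har⟩, fun a ha ↦ ?_, hu⟩
  have closure_Q : closure Q = Set.Iic (b, r) := by
    rw [closure_prod_eq, closure_pi_set]
    simp only [closure_Iio, Set.pi_univ_Iic, Set.Iic_prod_Iic]
  rw [← Set.mem_Iic, ← closure_Q] at ha
  exact closure_minimal (fun x hx ↦ (hQ x hx).le) (isClosed_le φ.continuous continuous_const) ha

theorem exists_multiplier_of_convex [Fintype κ] {C : Set ((κ → ℝ) × ℝ)} (hC : Convex ℝ C)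
    {b : κ → ℝ} {a₀ : (κ → ℝ) × ℝ} (ha₀ : a₀ ∈ C) (hslater : ∀ l, a₀.1 l < b l) {r : ℝ}
    (hr : ∀ a ∈ C, a.1 ≤ b → r ≤ a.2) :
    ∃ y : κ → ℝ, 0 ≤ y ∧ ∀ a ∈ C, r ≤ a.2 + y ⬝ᵥ (a.1 - b) := by
  classical
  obtain ⟨φ, u, hlt, hle, hu⟩ := exists_lt_forall_le_of_convex hC hr
  have φ_nonneg {v} (hv : 0 ≤ v) : 0 ≤ φ v :=
    nonneg_of_forall_map_Iic_le (φ := φ.toLinearMap) hle hv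
  set μ := φ (0, 1)
  set η : κ → ℝ := fun l ↦ φ (Pi.single l 1, 0)
  have φ_apply (v : κ → ℝ) (t : ℝ) : φ (v, t) = η ⬝ᵥ v + μ * t := by
    have h := LinearMap.pi_apply_eq_sum_univ (φ.toLinearMap ∘ₗ LinearMap.inl ℝ (κ → ℝ) ℝ) v
    have split : (v, t) = (v, 0) + t • ((0, 1) : (κ → ℝ) × ℝ) := by simp
    rw [split, map_add, map_smul, smul_eq_mul, mul_comm]
    congr 1
    have single_eq (l : κ) : (fun j ↦ if l = j then (1 : ℝ) else 0) = Pi.single l 1 := by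
      ext; simp [Pi.single_apply, eq_comm]
    simpa [η, dotProduct, single_eq, mul_comm] using h
  have μ_ne : μ ≠ 0 := fun hμ ↦ by
    have h₁ := hlt (a₀.1, r - 1) hslater (sub_one_lt r)
    have h₂ := hu a₀ ha₀
    rw [φ_apply, hμ, zero_mul, add_zero] at h₁
    rw [← Prod.mk.eta (p := a₀), φ_apply, hμ, zero_mul, add_zero] at h₂
    exact h₁.not_ge h₂
  have μ_pos : 0 < μ :=
    (φ_nonneg (v := (0, 1)) ⟨le_rfl, zero_le_one⟩).lt_of_ne' μ_ne
  refine ⟨μ⁻¹ • η, smul_nonneg (inv_nonneg.2 μ_pos.le) fun l ↦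
    φ_nonneg ⟨Pi.single_nonneg.2 zero_le_one, le_rfl⟩, fun a ha ↦ ?_⟩
  have h := (hle (b, r) le_rfl).trans (hu a ha)
  rw [← Prod.mk.eta (p := a), φ_apply, φ_apply] at h
  rw [smul_dotProduct, smul_eq_mul, dotProduct_sub]
  refine le_of_mul_le_mul_left ?_ μ_pos
  rw [mul_add, mul_inv_cancel_left₀ μ_ne]
  linarith

end Multipliers

section Counting

variable {ι : Type*}

theorem sum_map_le_card_mul_map_div {T : Finset ι} {g : ℝ → ℝ} {s : Set ℝ}
    (hg : ConcaveOn ℝ s g) {t : ι → ℝ} (ht : ∀ i ∈ T, t i ∈ s) :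
    ∑ i ∈ T, g (t i) ≤ T.card * g ((∑ i ∈ T, t i) / T.card) := by
  rcases T.eq_empty_or_nonempty with rfl | hT
  · simp
  have hcard : (0 : ℝ) < T.card := by exact_mod_cast hT.card_pos
  have jensen := hg.le_map_sum (w := fun _ ↦ (T.card : ℝ)⁻¹) (fun _ _ ↦ by positivity)
    (by simp [hcard.ne']) ht
  simp only [smul_eq_mul, ← Finset.mul_sum] at jensen
  rwa [inv_mul_le_iff₀ hcard, ← div_eq_inv_mul] at jensen

variable [Fintype ι] {k : ι → ℕ} {m : ℕ}

theorem sum_le_add_card_of_sum_le (hk : ∀ i, 1 ≤ k i) (hsum : ∑ i, k i ≤ m + Fintype.card ι)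
    (T : Finset ι) : ∑ i ∈ T, k i ≤ m + T.card := by
  classical
  have split := Finset.sum_add_sum_compl T k
  have compl_le : Tᶜ.card ≤ ∑ i ∈ Tᶜ, k i := by
    simpa using Finset.card_nsmul_le_sum Tᶜ k 1 fun i _ ↦ hk i
  have := T.card_add_card_compl
  omega

theorem card_filter_ne_one_le_of_sum_le (hk : ∀ i, 1 ≤ k i)
    (hsum : ∑ i, k i ≤ m + Fintype.card ι) : (Finset.univ.filter (k · ≠ 1)).card ≤ m := by
  set T := Finset.univ.filter (k · ≠ 1)
  have sum_le : ∑ i ∈ T, k i ≤ m + T.card := sum_le_add_card_of_sum_le hk hsum T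
  have le_sum : T.card * 2 ≤ ∑ i ∈ T, k i := T.card_nsmul_le_sum k 2 fun i hi ↦
    (hk i).lt_of_ne' (Finset.mem_filter.1 hi).2
  omega

/-- Only the indices with `k i ≠ 1` contribute, and there are at most `min (card ι) m` of them. -/
theorem sum_le_min_mul_of_concaveOn {g : ℝ → ℝ} (hg : ConcaveOn ℝ (Set.Ici 1) g)
    (hmono : MonotoneOn g (Set.Ici 1)) (hg1 : 0 ≤ g 1) (hk : ∀ i, 1 ≤ k i)
    (hsum : ∑ i, k i ≤ m + Fintype.card ι) {r : ι → ℝ} (hr : ∀ i, k i ≠ 1 → r i ≤ g (k i))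
    (hr1 : ∀ i, k i = 1 → r i ≤ 0) :
    ∑ i, r i ≤ (min (Fintype.card ι) m : ℕ) * g (1 + m / (min (Fintype.card ι) m : ℕ)) := by
  classical
  obtain ⟨T, hT, hTcard⟩ := Finset.exists_superset_card_eq
    (le_min (Finset.card_le_univ _) (card_filter_ne_one_le_of_sum_le hk hsum))
    (min_le_left (Fintype.card ι) m)
  have one_le (i) : (1 : ℝ) ≤ k i := Nat.one_le_cast.2 (hk i)
  have r_le (i) : r i ≤ g (k i) := by
    by_cases h : k i = 1
    · simpa [h] using (hr1 i h).trans hg1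
    · exact hr i h
  have compl_nonpos : ∑ i ∈ Tᶜ, r i ≤ 0 := Finset.sum_nonpos fun i hi ↦ hr1 i <| by
    by_contra h
    exact Finset.mem_compl.1 hi (hT (Finset.mem_filter.2 ⟨Finset.mem_univ i, h⟩))
  rw [← hTcard]
  rcases T.eq_empty_or_nonempty with rfl | hne
  · simpa using compl_nonpos
  have hcard : (0 : ℝ) < T.card := by exact_mod_cast hne.card_pos
  have mean_le : (∑ i ∈ T, (k i : ℝ)) / T.card ≤ 1 + m / T.card := by
    rw [div_le_iff₀ hcard, add_mul, div_mul_cancel₀ _ hcard.ne', one_mul, add_comm]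
    exact_mod_cast sum_le_add_card_of_sum_le hk hsum T
  have one_le_mean : 1 ≤ (∑ i ∈ T, (k i : ℝ)) / T.card := by
    rw [one_le_div hcard]
    simpa using Finset.card_nsmul_le_sum T (fun i ↦ (k i : ℝ)) 1 fun i _ ↦ one_le i
  calc ∑ i, r i ≤ ∑ i ∈ T, r i := by linarith [Finset.sum_add_sum_compl T r]
    _ ≤ ∑ i ∈ T, g (k i) := Finset.sum_le_sum fun i _ ↦ r_le i
    _ ≤ T.card * g ((∑ i ∈ T, (k i : ℝ)) / T.card) :=
        sum_map_le_card_mul_map_div hg fun i _ ↦ one_le i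
    _ ≤ T.card * g (1 + m / T.card) := mul_le_mul_of_nonneg_left
        (hmono one_le_mean (one_le_mean.trans mean_le) mean_le) hcard.le

end Counting

section ConvexifiedProblem

variable {ι κ : Type*} [Fintype ι] {E : ι → Type*} {D : ∀ i, Set (E i)} {F : ∀ i, E i → ℝ}

/-- Strong duality for the convexified problem. -/
theorem exists_convexWeights_sum_le [Fintype κ] {G : ∀ i, E i → κ → ℝ} {b : κ → ℝ} {d r : ℝ}
    (hd : ∀ y : κ → ℝ, 0 ≤ y →
      ∃ x : ∀ i, E i, (∀ i, x i ∈ D i) ∧ ∑ i, F i (x i) + y ⬝ᵥ (∑ i, G i (x i) - b) ≤ d)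
    {x₀ : ∀ i, E i} (hx₀ : ∀ i, x₀ i ∈ D i) (hslater : ∀ l, (∑ i, G i (x₀ i)) l < b l)
    (hr : d < r) :
    ∃ w : ∀ i, E i →₀ ℝ, (∀ i, w i ∈ convexWeights ℝ (D i)) ∧
      ∑ i, Finsupp.linearCombination ℝ (G i) (w i) ≤ b ∧
      ∑ i, Finsupp.linearCombination ℝ (F i) (w i) < r := by
  let T (w : ∀ i, E i →₀ ℝ) := ∑ i, Finsupp.linearCombination ℝ (fun x ↦ (G i x, F i x)) (w i)
  let C := T '' Set.univ.pi fun i ↦ convexWeights ℝ (D i)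
  have C_convex : Convex ℝ C := convex_image_sum_linearCombination _
  have single_mem {x : ∀ i, E i} (hx : ∀ i, x i ∈ D i) :
      (∑ i, G i (x i), ∑ i, F i (x i)) ∈ C :=
    ⟨fun i ↦ Finsupp.single (x i) 1, fun i _ ↦ single_mem_convexWeights (hx i), by
      simp [T, Prod.ext_iff, Prod.fst_sum, Prod.snd_sum]⟩
  by_contra! hcon
  obtain ⟨y, hy, hle⟩ := exists_multiplier_of_convex C_convex (single_mem hx₀) hslater
    (r := r) <| by
    rintro _ ⟨w, hw, rfl⟩ hwb
    simp only [T, Prod.fst_sum, Prod.snd_sum, fst_linearCombination, snd_linearCombination]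
      at hwb ⊢
    exact hcon w (fun i ↦ hw i trivial) hwb
  obtain ⟨x, hx, hxd⟩ := hd y hy
  linarith [hle _ (single_mem hx)]

/-- `IsJensenGapBound D F g` says that for every `k ≥ 2`, the value of `F` at a convex combination
of `k` points of `D` exceeds the same convex combination of values by at most `g k`, that is, that
the `k`th nonconvexity measure of `F` on `D` is at most `g k`. -/
def IsJensenGapBound {E : Type*} [AddCommGroup E] [Module ℝ E] (D : Set E) (F : E → ℝ)
    (g : ℝ → ℝ) : Prop :=
  ∀ w ∈ convexWeights ℝ D, 2 ≤ w.support.card →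
    F (Finsupp.linearCombination ℝ id w) ≤ Finsupp.linearCombination ℝ F w + g w.support.card

section

variable {E : Type*} [AddCommGroup E] [Module ℝ E] {D : Set E} {F : E → ℝ} {g : ℝ → ℝ}

theorem isJensenGapBound_neg_iff :
    IsJensenGapBound D (fun x ↦ -F x) g ↔ ∀ w ∈ convexWeights ℝ D, 2 ≤ w.support.card →
      Finsupp.linearCombination ℝ F w ≤
        F (Finsupp.linearCombination ℝ id w) + g w.support.card := by
  refine forall₃_congr fun w _ _ ↦ ?_
  have neg_eq : Finsupp.linearCombination ℝ (fun x ↦ -F x) w =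
      -Finsupp.linearCombination ℝ F w :=
    (Finsupp.apply_linearCombination ℝ (-LinearMap.id) F w).symm
  rw [neg_eq, neg_le, neg_add, neg_neg, ← sub_eq_add_neg, sub_le_iff_le_add]

theorem IsJensenGapBound.const_mul (h : IsJensenGapBound D F g) {c : ℝ} (hc : 0 ≤ c) :
    IsJensenGapBound D (fun x ↦ c * F x) fun t ↦ c * g t := by
  intro w hw hcard
  have mul_eq : Finsupp.linearCombination ℝ (fun x ↦ c * F x) w =
      c * Finsupp.linearCombination ℝ F w :=
    (Finsupp.apply_linearCombination ℝ (LinearMap.mulLeft ℝ c) F w).symm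
  rw [mul_eq, ← mul_add]
  exact mul_le_mul_of_nonneg_left (h w hw hcard) hc

end

theorem eq_single_of_card_support_eq_one {E : Type*} {D : Set E} {w : E →₀ ℝ}
    (hw : w ∈ convexWeights ℝ D) (hcard : w.support.card = 1) : ∃ x, w = Finsupp.single x 1 := by
  obtain ⟨x, hx⟩ := Finset.card_eq_one.1 hcard
  have hsum := sum_eq_one_of_mem_convexWeights hw
  rw [hx, Finset.sum_singleton] at hsum
  refine ⟨x, ?_⟩
  rw [← hsum]
  exact Finsupp.eq_single_iff.2 ⟨hx.subset, rfl⟩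

variable [∀ i, AddCommGroup (E i)] [∀ i, Module ℝ (E i)]

theorem exists_sum_le_of_convexWeights [Fintype κ] (hD : ∀ i, Convex ℝ (D i)) {g : ℝ → ℝ}
    (hg : ConcaveOn ℝ (Set.Ici 1) g) (hmono : MonotoneOn g (Set.Ici 1)) (hg1 : 0 ≤ g 1)
    (hF : ∀ i, IsJensenGapBound (D i) (F i) g) (A : ∀ i, E i →ₗ[ℝ] κ → ℝ)
    {w : ∀ i, E i →₀ ℝ} (hw : ∀ i, w i ∈ convexWeights ℝ (D i)) :
    ∃ x : ∀ i, E i, (∀ i, x i ∈ D i) ∧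
      ∑ i, A i (x i) = ∑ i, Finsupp.linearCombination ℝ (A i) (w i) ∧
      ∑ i, F i (x i) ≤ ∑ i, Finsupp.linearCombination ℝ (F i) (w i) +
        (min (Fintype.card ι) (Fintype.card κ) : ℕ) *
          g (1 + Fintype.card κ / (min (Fintype.card ι) (Fintype.card κ) : ℕ)) := by
  obtain ⟨w', hw', hA, hF', hcard⟩ := exists_convexWeights_sum_card_le (fun i ↦ ⇑(A i)) F hw
  rw [Module.finrank_fintype_fun_eq_card] at hcard
  let x (i) := Finsupp.linearCombination ℝ id (w' i)
  have gap_le := sum_le_min_mul_of_concaveOn hg hmono hg1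
    (fun i ↦ (support_nonempty_of_mem_convexWeights (hw' i)).card_pos) hcard
    (r := fun i ↦ F i (x i) - Finsupp.linearCombination ℝ (F i) (w' i))
    (fun i hi ↦ sub_le_iff_le_add'.2 (hF i _ (hw' i) ?_)) fun i hi ↦ ?_
  · refine ⟨x, fun i ↦ barycenter_mem_of_mem_convexWeights (hD i) (hw' i), ?_, ?_⟩
    · simp only [x, Finsupp.apply_linearCombination, Function.comp_id, hA]
    · rw [Finset.sum_sub_distrib] at gap_le
      linarith
  · have := (support_nonempty_of_mem_convexWeights (hw' i)).card_pos
    omega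
  · obtain ⟨z, hz⟩ := eq_single_of_card_support_eq_one (hw' i) hi
    simp [x, hz]

theorem exists_sum_lt_of_lagrangian_le [Fintype κ] (hD : ∀ i, Convex ℝ (D i)) {g : ℝ → ℝ}
    (hg : ConcaveOn ℝ (Set.Ici 1) g) (hmono : MonotoneOn g (Set.Ici 1)) (hg1 : 0 ≤ g 1)
    (hF : ∀ i, IsJensenGapBound (D i) (F i) g) (A : ∀ i, E i →ₗ[ℝ] κ → ℝ) {b : κ → ℝ} {d : ℝ}
    (hd : ∀ y : κ → ℝ, 0 ≤ y →
      ∃ x : ∀ i, E i, (∀ i, x i ∈ D i) ∧ ∑ i, F i (x i) + y ⬝ᵥ (∑ i, A i (x i) - b) ≤ d)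
    {x₀ : ∀ i, E i} (hx₀ : ∀ i, x₀ i ∈ D i) (hx₀b : ∑ i, A i (x₀ i) ≤ b) {ε : ℝ} (hε : 0 < ε) :
    ∃ x : ∀ i, E i, (∀ i, x i ∈ D i) ∧ ∑ i, A i (x i) ≤ b + Function.const κ ε ∧
      ∑ i, F i (x i) < d + ε + (min (Fintype.card ι) (Fintype.card κ) : ℕ) *
        g (1 + Fintype.card κ / (min (Fintype.card ι) (Fintype.card κ) : ℕ)) := by
  have relaxed (y : κ → ℝ) (hy : 0 ≤ y) : ∃ x : ∀ i, E i, (∀ i, x i ∈ D i) ∧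
      ∑ i, F i (x i) + y ⬝ᵥ (∑ i, A i (x i) - (b + Function.const κ ε)) ≤ d := by
    obtain ⟨x, hx, hxd⟩ := hd y hy
    refine ⟨x, hx, le_trans ?_ hxd⟩
    gcongr
    refine dotProduct_le_dotProduct_of_nonneg_left ?_ hy
    gcongr
    exact le_add_of_nonneg_right fun _ ↦ hε.le
  obtain ⟨w, hw, hwb, hwF⟩ := exists_convexWeights_sum_le relaxed hx₀
    (fun l ↦ (hx₀b l).trans_lt (lt_add_of_pos_right _ hε)) (lt_add_of_pos_right d hε)
  obtain ⟨x, hx, hAx, hFx⟩ := exists_sum_le_of_convexWeights hD hg hmono hg1 hF A hw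
  exact ⟨x, hx, hAx.trans_le hwb, hFx.trans_lt (by gcongr)⟩

end ConvexifiedProblem

section ERealSums

variable {ι : Type*} {s : Finset ι}

theorem ereal_coe_sum (s : Finset ι) (a : ι → ℝ) :
    ((∑ i ∈ s, a i : ℝ) : EReal) = ∑ i ∈ s, (a i : EReal) :=
  map_sum (⟨⟨Real.toEReal, EReal.coe_zero⟩, EReal.coe_add⟩ : ℝ →+ EReal) a s

theorem ereal_sum_ne_bot {a : ι → EReal} (ha : ∀ i ∈ s, a i ≠ ⊥) : ∑ i ∈ s, a i ≠ ⊥ :=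
  Finset.sum_induction a (· ≠ ⊥) (fun _ _ h₁ h₂ ↦ by simp [EReal.add_eq_bot_iff, h₁, h₂])
    EReal.zero_ne_bot ha

theorem ereal_sum_eq_top {a : ι → EReal} (ha : ∀ i ∈ s, a i ≠ ⊥) {i : ι} (hi : i ∈ s)
    (hai : a i = ⊤) : ∑ i ∈ s, a i = ⊤ := by
  classical
  rw [← Finset.add_sum_erase s a hi, hai]
  exact EReal.top_add_of_ne_bot (ereal_sum_ne_bot fun j hj ↦ ha j (Finset.mem_of_mem_erase hj))

theorem ereal_sum_ne_top {a : ι → EReal} (ha : ∀ i ∈ s, a i ≠ ⊤) :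
    ∑ i ∈ s, a i ≠ ⊤ :=
  Finset.sum_induction a (· ≠ ⊤) (fun _ _ h₁ h₂ ↦ EReal.add_ne_top h₁ h₂) EReal.zero_ne_top ha

theorem ereal_sum_neg {a : ι → EReal} (ha : ∀ i ∈ s, a i ≠ ⊤) :
    ∑ i ∈ s, -a i = -∑ i ∈ s, a i := by
  classical
  induction s using Finset.induction_on with
  | empty => simp
  | insert i s hi ih =>
    rw [Finset.forall_mem_insert] at ha
    rw [Finset.sum_insert hi, Finset.sum_insert hi, ih ha.2,
      EReal.neg_add (.inr (ereal_sum_ne_top ha.2)) (.inl ha.1), sub_eq_add_neg]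

theorem lowerSemicontinuous_ereal_sum {X : Type*} [TopologicalSpace X] {f : ι → X → EReal}
    (hf : ∀ i ∈ s, LowerSemicontinuous (f i)) (hbot : ∀ i ∈ s, ∀ x, f i x ≠ ⊥) :
    LowerSemicontinuous fun x ↦ ∑ i ∈ s, f i x := by
  classical
  induction s using Finset.induction_on with
  | empty => simpa using lowerSemicontinuous_const
  | insert i s hi ih =>
    simp only [Finset.forall_mem_insert] at hf hbot
    simp only [Finset.sum_insert hi]
    exact hf.1.add' (ih hf.2 hbot.2) fun x ↦
      EReal.continuousAt_add (.inr (ereal_sum_ne_bot fun j hj ↦ hbot.2 j hj x)) (.inl (hbot.1 x))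

end ERealSums

/-- The lower semicontinuous function `f` is finite exactly on the nonempty, relatively compact set
`D`, where it is given by the real-valued function `F`, and is `+∞` elsewhere. -/
structure IsLSCExtension {E : Type*} [TopologicalSpace E] (f : E → EReal) (D : Set E)
    (F : E → ℝ) : Prop where
  eq_coe : ∀ x ∈ D, f x = F x
  eq_top : ∀ x ∉ D, f x = ⊤
  nonempty : D.Nonempty
  isCompact_closure : IsCompact (closure D)
  lowerSemicontinuous : LowerSemicontinuous f

namespace IsLSCExtension

section

variable {E : Type*} [TopologicalSpace E] {f : E → EReal} {D : Set E} {F : E → ℝ}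

theorem ne_bot (hf : IsLSCExtension f D F) (x : E) : f x ≠ ⊥ := by
  by_cases hx : x ∈ D
  · simp [hf.eq_coe x hx]
  · simp [hf.eq_top x hx]

theorem exists_forall_sub_le (hf : IsLSCExtension f D F) {ℓ : E → ℝ} (hℓ : Continuous ℓ) :
    ∃ x ∈ D, ∀ x' ∈ D, ℓ x' - F x' ≤ ℓ x - F x := by
  have lsc : LowerSemicontinuous fun x ↦ f x + ((-ℓ x : ℝ) : EReal) :=
    hf.lowerSemicontinuous.add'
      (continuous_coe_real_ereal.comp hℓ.neg).lowerSemicontinuous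
      fun x ↦ EReal.continuousAt_add (.inr (EReal.coe_ne_bot _)) (.inr (EReal.coe_ne_top _))
  obtain ⟨x, -, hmin⟩ := (lsc.lowerSemicontinuousOn _).exists_isMinOn hf.nonempty.closure
    hf.isCompact_closure
  have le_of_mem {x'} (hx' : x' ∈ D) :
      f x + ((-ℓ x : ℝ) : EReal) ≤ ((F x' + -ℓ x' : ℝ) : EReal) := by
    rw [EReal.coe_add, ← hf.eq_coe x' hx']
    exact hmin (subset_closure hx')
  have hx : x ∈ D := by
    obtain ⟨x', hx'⟩ := hf.nonempty
    by_contra hx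
    have h := le_of_mem hx'
    rw [hf.eq_top x hx, EReal.top_add_coe, top_le_iff] at h
    exact EReal.coe_ne_top _ h
  refine ⟨x, hx, fun x' hx' ↦ ?_⟩
  have h := le_of_mem hx'
  rw [hf.eq_coe x hx, ← EReal.coe_add, EReal.coe_le_coe_iff] at h
  linarith

end

theorem exists_conjugateFun_eq {k : ℕ} {f : (Fin k → ℝ) → EReal} {D : Set (Fin k → ℝ)}
    {F : (Fin k → ℝ) → ℝ} (hf : IsLSCExtension f D F) (z : Fin k → ℝ) :
    ∃ x ∈ D, (∀ x' ∈ D, z ⬝ᵥ x' - F x' ≤ z ⬝ᵥ x - F x) ∧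
      conjugateFun f z = ((z ⬝ᵥ x - F x : ℝ) : EReal) := by
  obtain ⟨x, hx, hmax⟩ := hf.exists_forall_sub_le (ℓ := (z ⬝ᵥ ·)) (by fun_prop)
  refine ⟨x, hx, hmax, le_antisymm (iSup_le fun x' ↦ ?_) ?_⟩
  · by_cases hx' : x' ∈ D
    · rw [hf.eq_coe x' hx', ← EReal.coe_sub]
      exact_mod_cast hmax x' hx'
    · simp [hf.eq_top x' hx']
  · rw [EReal.coe_sub, ← hf.eq_coe x hx]
    exact le_iSup (fun x ↦ ((z ⬝ᵥ x : ℝ) : EReal) - f x) x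

end IsLSCExtension

section Duality

variable {n m : ℕ} {K : Fin n → ℕ}

/-- The Lagrangian of the separable problem with real-valued objectives. -/
def lagrangian (F : ∀ i, (Fin (K i) → ℝ) → ℝ) (A : ∀ i, Matrix (Fin m) (Fin (K i)) ℝ)
    (b : Fin m → ℝ) (x : ∀ i, Fin (K i) → ℝ) (y : Fin m → ℝ) : ℝ :=
  ∑ i, F i (x i) + y ⬝ᵥ (∑ i, A i *ᵥ x i - b)

theorem lagrangian_eq (F : ∀ i, (Fin (K i) → ℝ) → ℝ) (A : ∀ i, Matrix (Fin m) (Fin (K i)) ℝ)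
    (b : Fin m → ℝ) (x : ∀ i, Fin (K i) → ℝ) (y : Fin m → ℝ) :
    lagrangian F A b x y = -(∑ i, (-((A i)ᵀ *ᵥ y) ⬝ᵥ x i - F i (x i))) - b ⬝ᵥ y := by
  have adjoint (i) : y ⬝ᵥ A i *ᵥ x i = (A i)ᵀ *ᵥ y ⬝ᵥ x i := by
    rw [Matrix.mulVec_transpose, Matrix.dotProduct_mulVec]
  simp only [lagrangian, dotProduct_sub, dotProduct_sum, adjoint, neg_dotProduct,
    Finset.sum_sub_distrib, Finset.sum_neg_distrib, dotProduct_comm b]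
  ring

variable {f : ∀ i, (Fin (K i) → ℝ) → EReal} {D : ∀ i, Set (Fin (K i) → ℝ)}
  {F : ∀ i, (Fin (K i) → ℝ) → ℝ} {A : ∀ i, Matrix (Fin m) (Fin (K i)) ℝ} {b : Fin m → ℝ}

theorem sum_eq_coe_sum (hf : ∀ i, IsLSCExtension (f i) (D i) (F i)) {x : ∀ i, Fin (K i) → ℝ}
    (hx : ∀ i, x i ∈ D i) : ∑ i, f i (x i) = ((∑ i, F i (x i) : ℝ) : EReal) := by
  rw [ereal_coe_sum]
  exact Finset.sum_congr rfl fun i _ ↦ (hf i).eq_coe _ (hx i)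

theorem exists_dualObjective_eq_lagrangian (hf : ∀ i, IsLSCExtension (f i) (D i) (F i))
    (y : Fin m → ℝ) :
    ∃ x : ∀ i, Fin (K i) → ℝ, (∀ i, x i ∈ D i) ∧
      (∀ x' : ∀ i, Fin (K i) → ℝ, (∀ i, x' i ∈ D i) →
        lagrangian F A b x y ≤ lagrangian F A b x' y) ∧
      -(∑ i, conjugateFun (f i) (-((A i)ᵀ *ᵥ y))) - ((b ⬝ᵥ y : ℝ) : EReal) =
        (lagrangian F A b x y : EReal) := by
  choose x hx hmax hconj using fun i ↦ (hf i).exists_conjugateFun_eq (-((A i)ᵀ *ᵥ y))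
  refine ⟨x, hx, fun x' hx' ↦ ?_, ?_⟩
  · rw [lagrangian_eq, lagrangian_eq]
    exact sub_le_sub_right (neg_le_neg (Finset.sum_le_sum fun i _ ↦ hmax i (x' i) (hx' i))) _
  · simp only [hconj]
    rw [← ereal_coe_sum, ← EReal.coe_neg, ← EReal.coe_sub, lagrangian_eq]

theorem dualValue_le_primalValue (hf : ∀ i, IsLSCExtension (f i) (D i) (F i)) :
    dualValue f A b ≤ primalValue f A b := by
  refine iSup₂_le fun y hy ↦ le_iInf₂ fun x hxb ↦ ?_
  obtain ⟨x', -, hmin, heq⟩ := exists_dualObjective_eq_lagrangian (A := A) (b := b) hf y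
  by_cases hx : ∀ i, x i ∈ D i
  · rw [heq, sum_eq_coe_sum hf hx, EReal.coe_le_coe_iff]
    refine (hmin x hx).trans (add_le_of_nonpos_right ?_)
    simpa using dotProduct_le_dotProduct_of_nonneg_left (sub_nonpos.2 hxb) hy
  · obtain ⟨i, hi⟩ := not_forall.1 hx
    rw [ereal_sum_eq_top (fun i _ ↦ (hf i).ne_bot _) (Finset.mem_univ i) ((hf i).eq_top _ hi)]
    exact le_top

theorem exists_lagrangian_le_of_dualValue_le (hf : ∀ i, IsLSCExtension (f i) (D i) (F i)) {d : ℝ}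
    (hd : dualValue f A b ≤ d) {y : Fin m → ℝ} (hy : 0 ≤ y) :
    ∃ x : ∀ i, Fin (K i) → ℝ, (∀ i, x i ∈ D i) ∧ lagrangian F A b x y ≤ d := by
  obtain ⟨x, hx, -, heq⟩ := exists_dualObjective_eq_lagrangian (A := A) (b := b) hf y
  refine ⟨x, hx, EReal.coe_le_coe_iff.1 ?_⟩
  rw [← heq]
  exact (le_iSup₂ (f := fun (y : Fin m → ℝ) (_ : 0 ≤ y) ↦
    -(∑ i, conjugateFun (f i) (-((A i)ᵀ *ᵥ y))) - ((b ⬝ᵥ y : ℝ) : EReal)) y hy).trans hd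

theorem dualValue_ne_bot (hf : ∀ i, IsLSCExtension (f i) (D i) (F i)) : dualValue f A b ≠ ⊥ := by
  intro h
  obtain ⟨x, -, -, heq⟩ := exists_dualObjective_eq_lagrangian (A := A) (b := b) hf 0
  have hle := iSup₂_le_iff.1 h.le 0 le_rfl
  rw [heq, le_bot_iff] at hle
  exact EReal.coe_ne_bot _ hle

open Filter Topology in
theorem primalValue_le_of_forall_exists (hf : ∀ i, IsLSCExtension (f i) (D i) (F i)) {r : ℝ}
    (h : ∀ ε > 0, ∃ x : ∀ i, Fin (K i) → ℝ, (∀ i, x i ∈ D i) ∧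
      ∑ i, A i *ᵥ x i ≤ b + Function.const _ ε ∧ ∑ i, F i (x i) ≤ r + ε) :
    primalValue f A b ≤ r := by
  let S (ε : ℝ) : Set (∀ i, Fin (K i) → ℝ) :=
    {x | ∑ i, A i *ᵥ x i ≤ b + Function.const _ ε ∧ ∑ i, f i (x i) ≤ ((r + ε : ℝ) : EReal)}
  have S_mono {ε ε'} (hε : ε ≤ ε') : S ε ⊆ S ε' := fun x hx ↦
    ⟨hx.1.trans (by gcongr; exact fun _ ↦ hε), hx.2.trans (by gcongr)⟩
  have S_closed (ε) : IsClosed (S ε) := by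
    have hA : Continuous fun x : ∀ i, Fin (K i) → ℝ ↦ ∑ i, A i *ᵥ x i := by fun_prop
    refine (isClosed_le hA continuous_const).inter ?_
    refine (lowerSemicontinuous_ereal_sum (fun i _ ↦ ?_) fun i _ x ↦ ?_).isClosed_preimage _
    · exact (hf i).lowerSemicontinuous.comp (continuous_apply i)
    · exact (hf i).ne_bot _
  let δ (k : ℕ) : ℝ := 1 / (k + 1)
  choose x hxD hxb hxr using fun k ↦ h (δ k) Nat.one_div_pos_of_nat
  have x_mem (k) : x k ∈ S (δ k) :=
    ⟨hxb k, by rw [sum_eq_coe_sum hf (hxD k)]; exact_mod_cast hxr k⟩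
  have compact := isCompact_univ_pi fun i ↦ (hf i).isCompact_closure
  obtain ⟨a, -, φ, hφ, htends⟩ := compact.tendsto_subseq (x := x) fun k i _ ↦
    subset_closure (hxD k i)
  have a_mem {ε : ℝ} (hε : 0 < ε) : a ∈ S ε := by
    refine (S_closed ε).mem_of_tendsto htends ?_
    have δ_tendsto : Tendsto (δ ∘ φ) atTop (𝓝 0) :=
      tendsto_one_div_add_atTop_nhds_zero_nat.comp hφ.tendsto_atTop
    filter_upwards [δ_tendsto.eventually_lt_const hε] with k hk using S_mono hk.le (x_mem (φ k))
  have feasible : ∑ i, A i *ᵥ a i ≤ b := fun l ↦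
    le_of_forall_pos_le_add fun ε hε ↦ (a_mem hε).1 l
  refine (iInf₂_le a feasible).trans (EReal.le_of_forall_lt_iff_le.1 fun t ht ↦ ?_)
  simpa using (a_mem (sub_pos.2 (EReal.coe_lt_coe_iff.1 ht))).2

theorem exists_duality_gap_le (hf : ∀ i, IsLSCExtension (f i) (D i) (F i))
    (hD : ∀ i, Convex ℝ (D i)) {g : ℝ → ℝ} (hg : ConcaveOn ℝ (Set.Ici 1) g)
    (hmono : MonotoneOn g (Set.Ici 1)) (hg1 : 0 ≤ g 1) (hF : ∀ i, IsJensenGapBound (D i) (F i) g)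
    {x₀ : ∀ i, Fin (K i) → ℝ} (hx₀ : ∀ i, x₀ i ∈ D i) (hx₀b : ∑ i, A i *ᵥ x₀ i ≤ b) :
    ∃ p d : ℝ, primalValue f A b = p ∧ dualValue f A b = d ∧
      p - d ≤ (min n m : ℕ) * g (1 + m / (min n m : ℕ)) := by
  have primal_ne_top : primalValue f A b ≠ ⊤ := ne_top_of_le_ne_top (EReal.coe_ne_top _)
    ((iInf₂_le x₀ hx₀b).trans_eq (sum_eq_coe_sum hf hx₀))
  have dual_ne_bot : dualValue f A b ≠ ⊥ := dualValue_ne_bot hf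
  have weak : dualValue f A b ≤ primalValue f A b := dualValue_le_primalValue hf
  lift primalValue f A b to ℝ using ⟨primal_ne_top, ne_bot_of_le_ne_bot dual_ne_bot weak⟩ with p hp
  lift dualValue f A b to ℝ using ⟨ne_top_of_le_ne_top primal_ne_top weak, dual_ne_bot⟩ with d hd
  refine ⟨p, d, rfl, rfl, sub_le_iff_le_add'.2 <| EReal.coe_le_coe_iff.1 ?_⟩
  rw [hp]
  refine primalValue_le_of_forall_exists hf fun ε hε ↦ ?_
  obtain ⟨x, hx, hxb, hxF⟩ := exists_sum_lt_of_lagrangian_le hD hg hmono hg1 hF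
    (fun i ↦ (A i).mulVecLin) (fun y hy ↦ exists_lagrangian_le_of_dualValue_le hf hd.ge hy)
    hx₀ hx₀b hε
  refine ⟨x, hx, hxb, hxF.le.trans_eq ?_⟩
  simp only [Fintype.card_fin]
  ring

end Duality

section BoxObjective

section

variable {k : ℕ} {M : ℝ} {U : (Fin k → ℝ) → EReal}

theorem boxObjective_of_mem {x : Fin k → ℝ} (hx : x ∈ Set.Icc 0 (Function.const _ M)) :
    boxObjective M U x = -U x :=
  if_pos fun s ↦ ⟨hx.1 s, hx.2 s⟩

theorem boxObjective_of_notMem {x : Fin k → ℝ} (hx : x ∉ Set.Icc 0 (Function.const _ M)) :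
    boxObjective M U x = ⊤ :=
  if_neg fun h ↦ hx ⟨fun s ↦ (h s).1, fun s ↦ (h s).2⟩

theorem neg_le_boxObjective (x : Fin k → ℝ) : -U x ≤ boxObjective M U x := by
  rw [boxObjective]
  split_ifs
  exacts [le_rfl, le_top]

theorem boxObjective_ne_bot {x : Fin k → ℝ} (hU : U x ≠ ⊤) : boxObjective M U x ≠ ⊥ :=
  ne_bot_of_le_ne_bot (by simpa using hU) (neg_le_boxObjective x)

theorem lowerSemicontinuous_boxObjective (hU : ContinuousOn U (Set.Icc 0 (Function.const _ M))) :
    LowerSemicontinuous (boxObjective M U) := by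
  intro x y hy
  by_cases hx : x ∈ Set.Icc 0 (Function.const _ M)
  · rw [boxObjective_of_mem hx] at hy
    have hcont := continuous_neg.continuousAt.comp_continuousWithinAt (hU x hx)
    filter_upwards [eventually_nhdsWithin_iff.1 (hcont.eventually_const_lt hy)] with z hz
    by_cases hzM : z ∈ Set.Icc 0 (Function.const _ M)
    · exact (hz hzM).trans_le (neg_le_boxObjective z)
    · rw [boxObjective_of_notMem hzM]
      exact hy.trans_le le_top
  · rw [boxObjective_of_notMem hx] at hy
    filter_upwards [isClosed_Icc.isOpen_compl.mem_nhds hx] with z hz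
    rwa [boxObjective_of_notMem hz]

theorem isLSCExtension_boxObjective {D : Set (Fin k → ℝ)} {F : (Fin k → ℝ) → ℝ}
    (hU : ContinuousOn U (Set.Icc 0 (Function.const _ M)))
    (hD : ∀ x, x ∈ D ↔ x ∈ Set.Icc 0 (Function.const _ M) ∧ U x ≠ ⊥)
    (hF : ∀ x ∈ D, U x = ((-F x : ℝ) : EReal)) (hne : D.Nonempty) :
    IsLSCExtension (boxObjective M U) D F where
  eq_coe x hx := by
    rw [boxObjective_of_mem ((hD x).1 hx).1, hF x hx, ← EReal.coe_neg, neg_neg]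
  eq_top x hx := by
    by_cases hxM : x ∈ Set.Icc 0 (Function.const _ M)
    · rw [boxObjective_of_mem hxM, EReal.neg_eq_top_iff]
      by_contra hbot
      exact hx ((hD x).2 ⟨hxM, hbot⟩)
    · exact boxObjective_of_notMem hxM
  nonempty := hne
  isCompact_closure :=
    ((Metric.isBounded_Icc 0 (Function.const _ M)).subset fun x hx ↦
      ((hD x).1 hx).1).isCompact_closure
  lowerSemicontinuous := lowerSemicontinuous_boxObjective hU

end

theorem primalValue_boxObjective_eq_neg {n m : ℕ} {K : Fin n → ℕ} {M : ℝ}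
    {U : ∀ i, (Fin (K i) → ℝ) → EReal} {A : ∀ i, Matrix (Fin m) (Fin (K i)) ℝ} {b : Fin m → ℝ}
    (hU : ∀ i x, U i x ≠ ⊤)
    (hbox : ∀ x : ∀ i, Fin (K i) → ℝ, (∀ i, 0 ≤ x i) → ∑ i, A i *ᵥ x i ≤ b →
      ∀ i s, x i s ≤ M) :
    primalValue (fun i ↦ boxObjective M (U i)) A b = -utilityValue U A b := by
  apply le_antisymm
  · rw [EReal.le_neg]
    refine iSup₂_le fun x ⟨hx, hxb⟩ ↦ EReal.le_neg.1 ((iInf₂_le x hxb).trans_eq ?_)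
    rw [← ereal_sum_neg fun i _ ↦ hU i (x i)]
    exact Finset.sum_congr rfl fun i _ ↦ boxObjective_of_mem ⟨hx i, hbox x hx hxb i⟩
  · refine le_iInf₂ fun x hxb ↦ ?_
    by_cases hx : ∀ i, x i ∈ Set.Icc 0 (Function.const _ M)
    · rw [Finset.sum_congr rfl fun i _ ↦ boxObjective_of_mem (hx i),
        ereal_sum_neg fun i _ ↦ hU i (x i), EReal.neg_le_neg_iff]
      exact le_iSup₂ (f := fun (x : ∀ i, Fin (K i) → ℝ)
        (_ : (∀ i, 0 ≤ x i) ∧ ∑ i, A i *ᵥ x i ≤ b) ↦ ∑ i, U i (x i)) x ⟨fun i ↦ (hx i).1, hxb⟩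
    · obtain ⟨i, hi⟩ := not_forall.1 hx
      rw [ereal_sum_eq_top (fun j _ ↦ boxObjective_ne_bot (hU j (x j))) (Finset.mem_univ i)
        (boxObjective_of_notMem hi)]
      exact le_top

end BoxObjective

section MaxUtilities

section

variable {κ : Type*} [Finite κ]

theorem le_ciSup_of_finite (x : κ → ℝ) (s : κ) : x s ≤ ⨆ s, x s :=
  le_ciSup (Set.finite_range x).bddAbove s

variable [Nonempty κ]

theorem convex_setOf_nonneg_ciSup_pos : Convex ℝ {x : κ → ℝ | 0 ≤ x ∧ 0 < ⨆ s, x s} := by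
  have smul_add_mem {x y : κ → ℝ} (hx : 0 < ⨆ s, x s) (hy : 0 ≤ y) {a : ℝ} (ha : 0 < a) :
      0 < ⨆ s, (a • x + y) s := by
    obtain ⟨s, hs⟩ := exists_eq_ciSup_of_finite (f := x)
    exact (add_pos_of_pos_of_nonneg (mul_pos ha (hs ▸ hx)) (hy s)).trans_le
      (le_ciSup_of_finite (a • x + y) s)
  rintro x ⟨hx, hx'⟩ y ⟨hy, hy'⟩ a b ha hb hab
  refine ⟨add_nonneg (smul_nonneg ha hx) (smul_nonneg hb hy), ?_⟩
  rcases ha.eq_or_lt with rfl | ha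
  · rw [add_comm]
    exact smul_add_mem hy' (smul_nonneg le_rfl hx) (by linarith)
  · exact smul_add_mem hx' (smul_nonneg hb hy) ha

theorem continuous_ciSup_of_finite : Continuous fun x : κ → ℝ ↦ ⨆ s, x s := by
  cases nonempty_fintype κ
  simp_rw [← Finset.sup'_univ_eq_ciSup]
  exact Continuous.finset_sup'_apply _ fun s _ ↦ continuous_apply s

theorem linearCombination_ciSup_le_card_mul {D : Set (κ → ℝ)} (hD : ∀ x ∈ D, 0 ≤ x)
    {w : (κ → ℝ) →₀ ℝ} (hw : w ∈ convexWeights ℝ D) :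
    Finsupp.linearCombination ℝ (fun x ↦ ⨆ s, x s) w ≤
      w.support.card * ⨆ s, Finsupp.linearCombination ℝ id w s := by
  rw [← nsmul_eq_mul]
  refine Finset.sum_le_card_nsmul _ _ _ fun x hx ↦ ?_
  obtain ⟨s, hs⟩ := exists_eq_ciSup_of_finite (f := x)
  refine le_trans ?_ (le_ciSup_of_finite _ s)
  simp only [← hs, Finsupp.linearCombination_apply, Finsupp.sum, Finset.sum_apply]
  exact Finset.single_le_sum (f := fun z : κ → ℝ ↦ (w z • z) s)
    (fun z hz ↦ mul_nonneg (hw.1 z) (hD z (hw.2.1 hz) s)) hx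

theorem isJensenGapBound_neg_ciSup {D : Set (κ → ℝ)} (hD : ∀ x ∈ D, 0 ≤ x) {M : ℝ}
    (hM : ∀ x ∈ D, ∀ s, x s ≤ M) :
    IsJensenGapBound D (fun x ↦ -⨆ s, x s) fun t ↦ (1 - t⁻¹) * M := by
  refine isJensenGapBound_neg_iff.2 fun w hw hcard ↦ ?_
  have one_le_card : (1 : ℝ) ≤ w.support.card := by exact_mod_cast one_le_two.trans hcard
  set S := Finsupp.linearCombination ℝ (fun x : κ → ℝ ↦ ⨆ s, x s) w
  have S_le : S ≤ M := linearCombination_le_of_mem_convexWeights (fun x hx ↦ ciSup_le (hM x hx)) hw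
  calc S = (w.support.card : ℝ)⁻¹ * S + (1 - (w.support.card : ℝ)⁻¹) * S := by ring
    _ ≤ (⨆ s, Finsupp.linearCombination ℝ id w s) + (1 - (w.support.card : ℝ)⁻¹) * M := by
        gcongr
        · rw [inv_mul_le_iff₀ (by positivity)]
          exact linearCombination_ciSup_le_card_mul hD hw
        · exact sub_nonneg.2 (inv_le_one_of_one_le₀ one_le_card)

theorem isJensenGapBound_neg_log_ciSup {D : Set (κ → ℝ)} (hD : ∀ x ∈ D, 0 ≤ x)
    (hpos : ∀ x ∈ D, 0 < ⨆ s, x s) :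
    IsJensenGapBound D (fun x ↦ -Real.log (⨆ s, x s)) Real.log := by
  refine isJensenGapBound_neg_iff.2 fun w hw hcard ↦ ?_
  have card_pos : (0 : ℝ) < w.support.card := by exact_mod_cast two_pos.trans_le hcard
  set S := Finsupp.linearCombination ℝ (fun x : κ → ℝ ↦ ⨆ s, x s) w
  have S_pos : 0 < S :=
    (convex_Ioi (0 : ℝ)).sum_mem (fun x _ ↦ hw.1 x) (sum_eq_one_of_mem_convexWeights hw)
      fun x hx ↦ hpos x (hw.2.1 hx)
  have S_le := linearCombination_ciSup_le_card_mul hD hw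
  have sup_pos : 0 < ⨆ s, Finsupp.linearCombination ℝ id w s :=
    pos_of_mul_pos_right (S_pos.trans_le S_le) card_pos.le
  calc Finsupp.linearCombination ℝ (fun x : κ → ℝ ↦ Real.log (⨆ s, x s)) w
      ≤ Real.log S :=
        strictConcaveOn_log_Ioi.concaveOn.le_map_sum (fun x _ ↦ hw.1 x)
          (sum_eq_one_of_mem_convexWeights hw) fun x hx ↦ hpos x (hw.2.1 hx)
    _ ≤ Real.log (w.support.card * ⨆ s, Finsupp.linearCombination ℝ id w s) :=
        Real.log_le_log S_pos S_le
    _ = _ := by rw [Real.log_mul card_pos.ne' sup_pos.ne', add_comm]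

end

section

variable {k : ℕ}

theorem logUtility_eq (x : Fin k → ℝ) :
    logUtility x = ENNReal.log (ENNReal.ofReal (⨆ s, x s)) := by
  simp [ENNReal.log_ofReal, logUtility, ← not_le, ite_not]

theorem logUtility_ne_top (x : Fin k → ℝ) : logUtility x ≠ ⊤ := by
  rw [logUtility]
  split_ifs
  exacts [EReal.coe_ne_top _, bot_ne_top]

variable [NeZero k] {M : ℝ}

theorem isLSCExtension_throughput (hM : 0 ≤ M) :
    IsLSCExtension (boxObjective (k := k) M throughputUtility) (Set.Icc 0 (Function.const _ M))
      fun x ↦ -⨆ s, x s := by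
  refine isLSCExtension_boxObjective ?_ (fun x ↦ ?_) (fun x _ ↦ ?_) ⟨0, le_rfl, fun _ ↦ hM⟩
  · exact (continuous_coe_real_ereal.comp continuous_ciSup_of_finite).continuousOn
  · simp [throughputUtility]
  · simp [throughputUtility]

theorem isLSCExtension_log (hM : 0 < M) :
    IsLSCExtension (boxObjective (k := k) M logUtility)
      (Set.Icc 0 (Function.const _ M) ∩ {x | 0 ≤ x ∧ 0 < ⨆ s, x s})
      fun x ↦ -Real.log (⨆ s, x s) := by
  refine isLSCExtension_boxObjective ?_ (fun x ↦ ?_) (fun x hx ↦ ?_) ?_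
  · simp only [funext logUtility_eq]
    exact (ENNReal.continuous_log.comp
      (ENNReal.continuous_ofReal.comp continuous_ciSup_of_finite)).continuousOn
  · refine and_congr_right fun hx ↦ ?_
    simp [logUtility, hx.1]
  · rw [logUtility, if_pos hx.2.2, neg_neg]
  · exact ⟨Function.const _ M, ⟨fun _ ↦ hM.le, le_rfl⟩, fun _ ↦ hM.le, by simpa using hM⟩

end

end MaxUtilities

section Routing

theorem convexOn_inv_Ioi : ConvexOn ℝ (Set.Ioi 0) fun t : ℝ ↦ t⁻¹ := by
  simpa using convexOn_zpow (𝕜 := ℝ) (-1)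

section

variable {n m : ℕ} {K : Fin n → ℕ} {A : ∀ i, Matrix (Fin m) (Fin (K i)) ℝ} {c : Fin m → ℝ}
  {M : ℝ}

open Filter Topology in
theorem exists_pos_le_sum_mulVec_const_le (A : ∀ i, Matrix (Fin m) (Fin (K i)) ℝ)
    (hc : ∀ l, 0 < c l) (hM : 0 < M) :
    ∃ ε, 0 < ε ∧ ε ≤ M ∧ ∑ i, A i *ᵥ Function.const _ ε ≤ c := by
  have hcont : Continuous fun (ε : ℝ) (l : Fin m) ↦ (∑ i, A i *ᵥ Function.const _ ε) l := by
    fun_prop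
  have small (l) : ∀ᶠ ε in 𝓝 (0 : ℝ), (∑ i, A i *ᵥ Function.const _ ε) l < c l :=
    ((continuous_pi_iff.1 hcont l).tendsto' 0 0 (by simp)).eventually_lt_const (hc l)
  have feasible : ∀ᶠ ε in 𝓝[>] (0 : ℝ), ∀ l, (∑ i, A i *ᵥ Function.const _ ε) l < c l :=
    (eventually_all.2 small).filter_mono nhdsWithin_le_nhds
  obtain ⟨ε, hε, ⟨hε0, hεM⟩⟩ := (feasible.and (Ioc_mem_nhdsGT hM)).exists
  exact ⟨ε, hε0, hεM, fun l ↦ (hε l).le⟩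

variable [∀ i, NeZero (K i)]

theorem throughput_gap (hc : 0 ≤ c) (hM : 0 ≤ M) :
    ∃ p d : ℝ, primalValue (fun i ↦ boxObjective M throughputUtility) A c = p ∧
      dualValue (fun i ↦ boxObjective M throughputUtility) A c = d ∧
      p - d ≤ (min n m : ℕ) * (m / (m + (min n m : ℕ))) * M := by
  have concave : ConcaveOn ℝ (Set.Ici 1) fun t : ℝ ↦ (1 - t⁻¹) * M :=
    (((concaveOn_const 1 (convex_Ioi 0)).sub convexOn_inv_Ioi).smul hM).subset
      (Set.Ici_subset_Ioi.2 zero_lt_one) (convex_Ici 1) |>.congr fun t _ ↦ mul_comm M _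
  have mono : MonotoneOn (fun t : ℝ ↦ (1 - t⁻¹) * M) (Set.Ici 1) := fun s hs t _ hst ↦ by
    have : 0 < s := zero_lt_one.trans_le hs
    dsimp only
    gcongr
  obtain ⟨p, d, hp, hd, hgap⟩ := exists_duality_gap_le (A := A) (b := c)
    (fun i ↦ isLSCExtension_throughput hM) (fun i ↦ convex_Icc _ _) concave mono (by simp)
    (fun i ↦ isJensenGapBound_neg_ciSup (fun x hx ↦ hx.1) fun x hx ↦ hx.2)
    (fun i ↦ ⟨le_rfl, fun _ ↦ hM⟩) (by simpa using hc)
  refine ⟨p, d, hp, hd, hgap.trans_eq ?_⟩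
  rcases (min n m).eq_zero_or_pos with h | h
  · simp [h]
  · have : (0 : ℝ) < (min n m : ℕ) := by exact_mod_cast h
    field_simp
    ring

theorem log_gap (hc : ∀ l, 0 < c l) (hM : 0 < M) :
    ∃ p d : ℝ, primalValue (fun i ↦ boxObjective M logUtility) A c = p ∧
      dualValue (fun i ↦ boxObjective M logUtility) A c = d ∧
      p - d ≤ (min n m : ℕ) * Real.log (1 + m / (min n m : ℕ)) := by
  obtain ⟨ε, hε, hεM, hεc⟩ := exists_pos_le_sum_mulVec_const_le A hc hM
  have Ici_subset : Set.Ici (1 : ℝ) ⊆ Set.Ioi 0 := Set.Ici_subset_Ioi.2 zero_lt_one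
  exact exists_duality_gap_le (fun i ↦ isLSCExtension_log hM)
    (fun i ↦ (convex_Icc _ _).inter convex_setOf_nonneg_ciSup_pos)
    (strictConcaveOn_log_Ioi.concaveOn.subset Ici_subset (convex_Ici 1))
    (Real.strictMonoOn_log.monotoneOn.mono Ici_subset) (by simp)
    (fun i ↦ isJensenGapBound_neg_log_ciSup (fun x hx ↦ hx.2.1) fun x hx ↦ hx.2.2)
    (fun i ↦ ⟨⟨fun _ ↦ hε.le, fun _ ↦ hεM⟩, fun _ ↦ hε.le, by simpa using hε⟩) hεc

end

theorem routingMatrix_mulVec {L k : ℕ} (path : Fin k → Finset (Fin L)) (x : Fin k → ℝ)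
    (l : Fin L) : (routingMatrix path *ᵥ x) l = ∑ s, if l ∈ path s then x s else 0 := by
  simp [routingMatrix, Matrix.mulVec, dotProduct]

theorem routingMatrix_mulVec_nonneg {L k : ℕ} (path : Fin k → Finset (Fin L)) {x : Fin k → ℝ}
    (hx : 0 ≤ x) : 0 ≤ routingMatrix path *ᵥ x := fun l ↦ by
  rw [routingMatrix_mulVec]
  exact Finset.sum_nonneg fun s _ ↦ ite_nonneg (hx s) le_rfl

theorem le_routingMatrix_mulVec {L k : ℕ} {path : Fin k → Finset (Fin L)} {x : Fin k → ℝ}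
    (hx : 0 ≤ x) {l : Fin L} {s : Fin k} (hl : l ∈ path s) : x s ≤ (routingMatrix path *ᵥ x) l := by
  rw [routingMatrix_mulVec]
  simpa [hl] using Finset.single_le_sum (f := fun s ↦ if l ∈ path s then x s else 0)
    (fun s _ ↦ ite_nonneg (hx s) le_rfl) (Finset.mem_univ s)

theorem le_norm_of_sum_routingMatrix_mulVec_le {N L : ℕ} {K : Fin N → ℕ}
    {path : ∀ i, Fin (K i) → Finset (Fin L)} (hpath : ∀ i s, (path i s).Nonempty)
    {c : Fin L → ℝ} {x : ∀ i, Fin (K i) → ℝ} (hx : ∀ i, 0 ≤ x i)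
    (hxc : ∑ i, routingMatrix (path i) *ᵥ x i ≤ c) (i : Fin N) (s : Fin (K i)) : x i s ≤ ‖c‖ := by
  obtain ⟨l, hl⟩ := hpath i s
  calc x i s ≤ (routingMatrix (path i) *ᵥ x i) l := le_routingMatrix_mulVec (hx i) hl
    _ ≤ (∑ i, routingMatrix (path i) *ᵥ x i) l :=
        Finset.single_le_sum (f := fun i ↦ routingMatrix (path i) *ᵥ x i)
          (fun i _ ↦ routingMatrix_mulVec_nonneg (path i) (hx i)) (Finset.mem_univ i) l
    _ ≤ c l := hxc l
    _ ≤ ‖c‖ := (Real.le_norm_self _).trans (norm_le_pi_norm c l)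

end Routing

section SpectrumManagement

section

variable {κ : Type*} [Fintype κ] {σ s : ℝ} {x : κ → ℝ}

/-- The total rate on a tone with noise `σ`, without the normalisation by the number of tones and
with `∑ j, x j` in place of the `ℓ¹`-norm, which is the same for the nonnegative `x` of interest. -/
noncomputable def toneLogSum (σ : ℝ) (x : κ → ℝ) : ℝ :=
  ∑ l, Real.log (1 + x l / (∑ j, x j - x l + σ))

theorem interference_pos (hσ : 0 < σ) (hx : 0 ≤ x) (l : κ) : 0 < ∑ j, x j - x l + σ :=
  add_pos_of_nonneg_of_pos
    (sub_nonneg.2 (Finset.single_le_sum (fun j _ ↦ hx j) (Finset.mem_univ l))) hσ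

theorem one_add_signal_div_interference (hσ : 0 < σ) (hx : 0 ≤ x) (l : κ) :
    1 + x l / (∑ j, x j - x l + σ) = (∑ j, x j + σ) / (∑ j, x j - x l + σ) := by
  rw [one_add_div (interference_pos hσ hx l).ne']
  ring

theorem sum_div_sum_add_le_toneLogSum (hσ : 0 < σ) (hx : 0 ≤ x) :
    (∑ j, x j) / (∑ j, x j + σ) ≤ toneLogSum σ x := by
  have hS : 0 < ∑ j, x j + σ := add_pos_of_nonneg_of_pos (Finset.sum_nonneg fun j _ ↦ hx j) hσ
  rw [Finset.sum_div]
  refine Finset.sum_le_sum fun l _ ↦ ?_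
  rw [one_add_signal_div_interference hσ hx]
  calc x l / (∑ j, x j + σ) = 1 - ((∑ j, x j + σ) / (∑ j, x j - x l + σ))⁻¹ := by
        rw [inv_div, one_sub_div hS.ne']
        ring
    _ ≤ _ := Real.one_sub_inv_le_log_of_pos (div_pos hS (interference_pos hσ hx l))

theorem toneLogSum_nonneg (hσ : 0 < σ) (hx : 0 ≤ x) : 0 ≤ toneLogSum σ x :=
  have hS : 0 ≤ ∑ j, x j := Finset.sum_nonneg fun j _ ↦ hx j
  (div_nonneg hS (add_nonneg hS hσ.le)).trans (sum_div_sum_add_le_toneLogSum hσ hx)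

/-- Concavity of the logarithm between `σ` and `S + σ`. -/
theorem log_div_sub_add_le {S t : ℝ} (hσ : 0 < σ) (hS : 0 < S) (ht : 0 ≤ t) (htS : t ≤ S) :
    Real.log ((S + σ) / (S - t + σ)) ≤ t / S * (Real.log (S + σ) - Real.log σ) := by
  have hSσ : 0 < S + σ := add_pos hS hσ
  have concave := strictConcaveOn_log_Ioi.concaveOn.2 hSσ hσ
    (sub_nonneg.2 (div_le_one_of_le₀ htS hS.le)) (div_nonneg ht hS.le) (sub_add_cancel 1 (t / S))
  have combination : (1 - t / S) • (S + σ) + (t / S) • σ = S - t + σ := by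
    simp only [smul_eq_mul]
    field_simp
    ring
  rw [combination, smul_eq_mul, smul_eq_mul] at concave
  rw [Real.log_div hSσ.ne' (by linarith)]
  linarith

theorem toneLogSum_le_log_sub_log (hσ : 0 < σ) (hx : 0 ≤ x) :
    toneLogSum σ x ≤ Real.log (∑ j, x j + σ) - Real.log σ := by
  rcases (Finset.sum_nonneg fun j _ ↦ hx j : 0 ≤ ∑ j, x j).eq_or_lt' with hS | hS
  · have x_eq : x = 0 := (Fintype.sum_eq_zero_iff_of_nonneg hx).1 hS
    simp [toneLogSum, x_eq]
  calc toneLogSum σ x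
      ≤ ∑ l, x l / (∑ j, x j) * (Real.log (∑ j, x j + σ) - Real.log σ) :=
        Finset.sum_le_sum fun l _ ↦ by
          rw [one_add_signal_div_interference hσ hx]
          exact log_div_sub_add_le hσ hS (hx l)
            (Finset.single_le_sum (fun j _ ↦ hx j) (Finset.mem_univ l))
    _ = _ := by rw [← Finset.sum_mul, ← Finset.sum_div, div_self hS.ne', one_mul]

theorem toneLogSum_le_one_sub_log (hσ : 0 < σ) (hσ1 : σ ≤ 1) (hx : 0 ≤ x) (hx1 : ∀ l, x l ≤ 1) :
    toneLogSum σ x ≤ 1 - Real.log σ := by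
  have hS : 0 ≤ ∑ j, x j := Finset.sum_nonneg fun j _ ↦ hx j
  rcases le_total (∑ j, x j + σ) 2 with h | h
  · linarith [toneLogSum_le_log_sub_log hσ hx,
      Real.log_le_sub_one_of_pos (add_pos_of_nonneg_of_pos hS hσ)]
  have hv : 0 < ∑ j, x j - 1 + σ := by linarith
  calc toneLogSum σ x ≤ ∑ l, x l / (∑ j, x j - 1 + σ) := Finset.sum_le_sum fun l _ ↦ by
        have hl := interference_pos hσ hx l
        have hxl : 0 ≤ x l := hx l
        calc Real.log (1 + x l / (∑ j, x j - x l + σ)) ≤ x l / (∑ j, x j - x l + σ) := by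
              linarith [Real.log_le_sub_one_of_pos
                (show 0 < 1 + x l / (∑ j, x j - x l + σ) by positivity)]
          _ ≤ x l / (∑ j, x j - 1 + σ) := by
              gcongr
              exact hx1 l
    _ = (∑ l, x l) / (∑ j, x j - 1 + σ) := (Finset.sum_div _ _ _).symm
    _ ≤ 2 - σ := by
        rw [div_le_iff₀ hv]
        nlinarith
    _ ≤ 1 - Real.log σ := by linarith [Real.log_le_sub_one_of_pos hσ]

theorem concaveOn_log_sum_add_sub_log (hσ : 0 < σ) :
    ConcaveOn ℝ (Set.Ici 0) fun x : κ → ℝ ↦ Real.log (∑ j, x j + σ) - Real.log σ := by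
  have h := ((strictConcaveOn_log_Ioi.concaveOn.translate_left σ).comp_linearMap
    (∑ j : κ, LinearMap.proj j : (κ → ℝ) →ₗ[ℝ] ℝ)).add_const (-Real.log σ)
  refine (h.subset (fun x hx ↦ ?_) (convex_Ici 0)).congr fun x _ ↦ ?_
  · simpa using neg_lt_zero.2 hσ |>.trans_le (Finset.sum_nonneg fun j _ ↦ hx j)
  · simp [sub_eq_add_neg]

theorem linearCombination_toneLogSum_le (hσ : 0 < σ) (hσ1 : σ ≤ 1) {w : (κ → ℝ) →₀ ℝ}
    (hw : w ∈ convexWeights ℝ (Set.Icc 0 (Function.const κ 1))) :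
    Finsupp.linearCombination ℝ (toneLogSum σ) w ≤
      toneLogSum σ (Finsupp.linearCombination ℝ id w) + Real.log (2 / σ) := by
  have hy := (barycenter_mem_of_mem_convexWeights (convex_Icc _ _) hw).1
  set y := Finsupp.linearCombination ℝ id w
  have hS : 0 < ∑ j, y j + σ := add_pos_of_nonneg_of_pos (Finset.sum_nonneg fun j _ ↦ hy j) hσ
  rw [Real.log_div two_ne_zero hσ.ne']
  rcases le_total (∑ j, y j + σ) 2 with h | h
  · have jensen : Finsupp.linearCombination ℝ (toneLogSum σ) w ≤
        Real.log (∑ j, y j + σ) - Real.log σ :=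
      linearCombination_le_of_concaveOn
        ((concaveOn_log_sum_add_sub_log hσ).subset (fun x hx ↦ hx.1) (convex_Icc _ _))
        (fun x hx ↦ toneLogSum_le_log_sub_log hσ hx.1) hw
    linarith [Real.log_le_log hS h, toneLogSum_nonneg hσ hy]
  · have le_one : Finsupp.linearCombination ℝ (toneLogSum σ) w ≤ 1 - Real.log σ :=
      linearCombination_le_of_mem_convexWeights
        (fun x hx ↦ toneLogSum_le_one_sub_log hσ hσ1 hx.1 hx.2) hw
    have half_le : 1 / 2 ≤ toneLogSum σ y := by
      refine le_trans ?_ (sum_div_sum_add_le_toneLogSum hσ hy)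
      rw [div_le_div_iff₀ two_pos hS]
      linarith
    linarith [Real.log_two_gt_d9]

theorem isJensenGapBound_neg_toneLogSum (hs : 0 < s) (hsσ : s ≤ σ) (hσ1 : σ ≤ 1) :
    IsJensenGapBound (Set.Icc 0 (Function.const κ 1)) (fun x ↦ -toneLogSum σ x)
      fun t ↦ Real.log (t / s) := by
  refine isJensenGapBound_neg_iff.2 fun w hw hcard ↦ ?_
  refine (linearCombination_toneLogSum_le (hs.trans_le hsσ) hσ1 hw).trans ?_
  have : (2 : ℝ) ≤ w.support.card := by exact_mod_cast hcard
  have : 0 < σ := hs.trans_le hsσ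
  gcongr

end

section

variable {L : ℕ} {σ : ℝ}

theorem sum_toneRate_of_nonneg (N : ℕ) {x : Fin L → ℝ} (hx : 0 ≤ x) :
    ∑ l, toneRate N σ x l = 1 / N * toneLogSum σ x := by
  simp only [toneRate, toneLogSum, Finset.mul_sum, abs_of_nonneg (hx _)]

theorem continuousOn_toneThroughput (N : ℕ) (hσ : 0 < σ) :
    ContinuousOn (toneThroughput (L := L) N σ) (Set.Ici 0) := by
  have denom_pos (x : Fin L → ℝ) (l) : 0 < ∑ j, |x j| - x l + σ := by
    have := Finset.single_le_sum (fun j _ ↦ abs_nonneg (x j)) (Finset.mem_univ l)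
    linarith [le_abs_self (x l)]
  refine continuous_coe_real_ereal.comp_continuousOn (continuousOn_finsetSum _ fun l _ ↦ ?_)
  refine continuousOn_const.mul (ContinuousOn.log ?_ fun x hx ↦ ?_)
  · exact continuousOn_const.add
      (ContinuousOn.div (by fun_prop) (by fun_prop) fun x _ ↦ (denom_pos x l).ne')
  · exact (add_pos_of_pos_of_nonneg one_pos (div_nonneg (hx l) (denom_pos x l).le)).ne'

theorem isLSCExtension_toneThroughput (N : ℕ) (hσ : 0 < σ) :
    IsLSCExtension (boxObjective (k := L) 1 (toneThroughput N σ))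
      (Set.Icc 0 (Function.const _ 1)) fun x ↦ 1 / N * -toneLogSum σ x := by
  refine isLSCExtension_boxObjective
    ((continuousOn_toneThroughput N hσ).mono fun x hx ↦ hx.1) (fun x ↦ ?_) (fun x hx ↦ ?_)
    ⟨0, le_rfl, fun _ ↦ zero_le_one⟩
  · simp [toneThroughput]
  · rw [toneThroughput, sum_toneRate_of_nonneg N hx.1, mul_neg, neg_neg]

theorem spectrum_gap {N : ℕ} [NeZero N] {σ : Fin N → ℝ} (hσ : ∀ i, 0 < σ i ∧ σ i ≤ 1)
    {P : Fin L → ℝ} (hP : 0 ≤ P) :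
    ∃ p d : ℝ,
      primalValue (K := fun _ ↦ L) (fun i ↦ boxObjective 1 (toneThroughput N (σ i)))
        (fun _ ↦ 1) P = p ∧
      dualValue (K := fun _ ↦ L) (fun i ↦ boxObjective 1 (toneThroughput N (σ i)))
        (fun _ ↦ 1) P = d ∧
      p - d ≤ (min N L : ℕ) / N * Real.log ((1 + L / (min N L : ℕ)) / ⨅ i, σ i) := by
  obtain ⟨i₀, hi₀⟩ := exists_eq_ciInf_of_finite (f := σ)
  have le_σ (i) : ⨅ i, σ i ≤ σ i := ciInf_le (Set.finite_range σ).bddBelow i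
  set s := ⨅ i, σ i
  have hs : 0 < s := hi₀ ▸ (hσ i₀).1
  have hN : (0 : ℝ) ≤ 1 / N := by positivity
  have Ici_subset : Set.Ici (1 : ℝ) ⊆ Set.Ioi 0 := Set.Ici_subset_Ioi.2 zero_lt_one
  have concave : ConcaveOn ℝ (Set.Ici 1) fun t ↦ 1 / (N : ℝ) * Real.log (t / s) :=
    ((strictConcaveOn_log_Ioi.concaveOn.add_const (-Real.log s)).smul hN).subset Ici_subset
      (convex_Ici 1) |>.congr fun t ht ↦ by
        simp [Real.log_div (Ici_subset ht).ne' hs.ne', sub_eq_add_neg]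
  have mono : MonotoneOn (fun t ↦ 1 / (N : ℝ) * Real.log (t / s)) (Set.Ici 1) :=
    fun t ht u _ htu ↦ by
      have : 0 < t := Ici_subset ht
      dsimp only
      gcongr
  have nonneg : 0 ≤ 1 / (N : ℝ) * Real.log (1 / s) :=
    mul_nonneg hN (Real.log_nonneg (one_le_one_div hs ((le_σ i₀).trans (hσ i₀).2)))
  obtain ⟨p, d, hp, hd, hgap⟩ := exists_duality_gap_le (K := fun _ ↦ L) (A := fun _ ↦ 1) (b := P)
    (fun i ↦ isLSCExtension_toneThroughput N (hσ i).1) (fun _ ↦ convex_Icc _ _) concave mono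
    nonneg (fun i ↦ (isJensenGapBound_neg_toneLogSum hs (le_σ i) (hσ i).2).const_mul hN)
    (x₀ := fun _ ↦ 0) (fun _ ↦ ⟨le_rfl, fun _ ↦ zero_le_one⟩) (by simpa using hP)
  exact ⟨p, d, hp, hd, hgap.trans_eq (by ring)⟩

theorem le_of_sum_one_mulVec_le {N : ℕ} {P : Fin L → ℝ} {x : Fin N → Fin L → ℝ}
    (hx : ∀ i, 0 ≤ x i) (hxP : ∑ i, (1 : Matrix (Fin L) (Fin L) ℝ) *ᵥ x i ≤ P) (i : Fin N) :
    x i ≤ P := by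
  simp only [Matrix.one_mulVec] at hxP
  exact (Finset.single_le_sum (fun i _ ↦ hx i) (Finset.mem_univ i)).trans hxP

end

end SpectrumManagement

theorem mainTheorem9 (N L : ℕ) (hN : 1 ≤ N) (hL : 1 ≤ L) :
    -- single-path routing: `N` users, `L` links with capacities `c`, `‖c‖` is the sup norm
    (∀ (c : Fin L → ℝ), (∀ l, 0 < c l) →
      ∀ (K : Fin N → ℕ), (∀ i, 1 ≤ K i) →
      ∀ (path : ∀ i, Fin (K i) → Finset (Fin L)),
        -- throughput utility
        (∃ p d : ℝ,
          primalValue (fun i => boxObjective (k := K i) ‖c‖ throughputUtility)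
            (fun i => routingMatrix (path i)) c = (p : EReal) ∧
          dualValue (fun i => boxObjective (k := K i) ‖c‖ throughputUtility)
            (fun i => routingMatrix (path i)) c = (d : EReal) ∧
          p - d ≤ (min N L : ℕ) * ((L : ℝ) / ((L : ℝ) + (min N L : ℕ))) * ‖c‖) ∧
        -- logarithmic utility
        (∃ p d : ℝ,
          primalValue (fun i => boxObjective (k := K i) ‖c‖ logUtility)
            (fun i => routingMatrix (path i)) c = (p : EReal) ∧
          dualValue (fun i => boxObjective (k := K i) ‖c‖ logUtility)
            (fun i => routingMatrix (path i)) c = (d : EReal) ∧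
          p - d ≤ (min N L : ℕ) * Real.log (1 + (L : ℝ) / (min N L : ℕ))) ∧
        -- if every path passes through a link, these are the utility maximisation problems
        ((∀ i s, (path i s).Nonempty) →
          primalValue (fun i => boxObjective (k := K i) ‖c‖ throughputUtility)
              (fun i => routingMatrix (path i)) c =
            -utilityValue (fun i => throughputUtility (k := K i))
              (fun i => routingMatrix (path i)) c ∧
          primalValue (fun i => boxObjective (k := K i) ‖c‖ logUtility)
              (fun i => routingMatrix (path i)) c =
            -utilityValue (fun i => logUtility (k := K i))
              (fun i => routingMatrix (path i)) c)) ∧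
    -- dynamic spectrum management: `L` users, `N` tones, noises `σ i`, power budgets `P l`
    (∀ (σ : Fin N → ℝ), (∀ i, 0 < σ i ∧ σ i ≤ 1) →
      ∀ (P : Fin L → ℝ), (∀ l, 0 ≤ P l ∧ P l ≤ 1) →
        (∃ p d : ℝ,
          primalValue (K := fun _ => L) (fun i => boxObjective 1 (toneThroughput N (σ i)))
            (fun _ => 1) P = (p : EReal) ∧
          dualValue (K := fun _ => L) (fun i => boxObjective 1 (toneThroughput N (σ i)))
            (fun _ => 1) P = (d : EReal) ∧
          p - d ≤ ((min N L : ℕ) : ℝ) / N *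
            Real.log ((1 + (L : ℝ) / (min N L : ℕ)) / ⨅ i, σ i)) ∧
        primalValue (K := fun _ => L) (fun i => boxObjective 1 (toneThroughput N (σ i)))
            (fun _ => 1) P =
          -utilityValue (K := fun _ => L) (fun i => toneThroughput N (σ i)) (fun _ => 1) P) := by
  have : NeZero N := NeZero.of_pos hN
  have : NeZero L := NeZero.of_pos hL
  refine ⟨fun c hc K hK path ↦ ?_, fun σ hσ P hP ↦ ⟨spectrum_gap hσ fun l ↦ (hP l).1, ?_⟩⟩
  · have neZero_K (i) : NeZero (K i) := NeZero.of_pos (hK i)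
    have norm_pos : 0 < ‖c‖ := norm_pos_iff.2 fun h ↦ (hc 0).ne' (congrFun h 0)
    refine ⟨throughput_gap (fun l ↦ (hc l).le) (norm_nonneg c), log_gap hc norm_pos,
      fun hpath ↦ ⟨?_, ?_⟩⟩
    · exact primalValue_boxObjective_eq_neg (fun _ _ ↦ EReal.coe_ne_top _)
        fun x hx hxc ↦ le_norm_of_sum_routingMatrix_mulVec_le hpath hx hxc
    · exact primalValue_boxObjective_eq_neg (fun _ _ ↦ logUtility_ne_top _)
        fun x hx hxc ↦ le_norm_of_sum_routingMatrix_mulVec_le hpath hx hxc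
  · exact primalValue_boxObjective_eq_neg (K := fun _ ↦ L) (fun _ _ ↦ EReal.coe_ne_top _)
      fun x hx hxP i l ↦ (le_of_sum_one_mulVec_le hx hxP i l).trans (hP l).2
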